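/- Graphs are finite and may have parallel edges; paths and circuits are regarded as graphs. For a graph $G$ and $T\subseteq V(G)$, a \emph{join} of $(G,T)$ is a set $F\subseteq E(G)$ such that, for every $v\in V(G)$, the number of edges of $F$ between $v$ and $V(G)\setminus\{v\}$ is odd if and only if $v\in T$. The pair $(G,T)$ is a \emph{graft} if every connected component of $G$ contains an even number of vertices of $T$ (equivalently, if it has a join), and then $\nu(G,T)$ denotes the minimum number of edges of a join. A \emph{bipartite graft with an ordered bipartition} $(G,T;A,B)$ is a graft $(G,T)$ together with an ordered pair of disjoint (possibly empty) sets $A,B$ with $A\cup B=V(G)$ such that every edge of $G$ joins $A$ and $B$. Such a graft is a \emph{critical quasicomb with root} $r\in B$ if, for every $x\in V(G)\setminus\{r\}$, $(G,T\Delta\{x,r\})$ is a graft with $$\nu(G,T\Delta\{x,r\})-\nu(G,T)=\begin{cases}1 & \text{if } x\in A,\\ 0 & \text{if } x\in B\setminus\{r\}.\end{cases}$$ Let $(G,T;A,B)$ and $(P,T';A',B')$ be bipartite grafts with an ordered bipartition such that edges common to $G$ and $P$ have the same ends in both, $A\cap B'=\emptyset$ and $A'\cap B=\emptyset$. Their \emph{sum}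 is $(G+P,\,T\Delta T';\,A\cup A',\,B\cup B')$. The graft $(P,T';A',B')$ is an \emph{ear graft} relative to $(G,T;A,B)$ if $E(P)\ne\emptyset$ and $P$ is either \emph{round}, that is, a path whose two ends, and no other vertices, belong to $V(G)$, or a circuit that has exactly one vertex in common with $V(G)$; or \emph{straight}, that is, a path one of whose ends is its only vertex in $V(G)$. The vertices in $V(P)\cap V(G)$ are its \emph{bonds}. An ear graft is \emph{effective} if 1. every vertex of $B'$ that is not a bond belongs to $T'$; 2. no bond in $B'$ belongs to $T'$; 3. if $P$ is straight, with bond $s$ and other end $v$, then $v\in A'$ implies $v\notin T'$, $s\in A'$ implies $s\in T'$, and all vertices of $P$ other than $s$ and $v$ belong to $T'$. Let $\mathcal C(r)$ be the smallest family of quadruples that contains $((\{r\},\emptyset),\emptyset;\emptyset,\{r\})$ and that contains, with every member $(G,T;A,B)$ and every effective ear graft relative to it, their sum. \textbf{Theorem.} A quadruple $(G,T;A,B)$ is a bipartite graft with an ordered bipartition that is a critical quasicomb with root $r$ if and only if it is a member of $\mathcal C(r)$. -/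

import Mathlib

open scoped symmDiff

namespace BipGraft

open Graph

section

variable {α β : Type*}

/-! ### Joins and grafts (multigraphs are Mathlib's `Graph α β`) -/

/-- `F` is a join of `(G, T)`: `F` is a set of edges such that the number of edges of `F` between
`v` and `V(G) \ {v}` is odd for `v ∈ T` and even for `v ∈ V(G) \ T`. -/
def IsJoin (G : Graph α β) (T : Set α) (F : Set β) : Prop :=
  F ⊆ E(G) ∧ ∀ v ∈ V(G), Odd {e ∈ F | G.IsNonloopAt e v}.ncard ↔ v ∈ T

/-- `ν(G, T)`, the number of edges in a minimum join of `(G, T)`. It is `⊤` exactly when `(G, T)`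
has no finite join; for a finite graph, exactly when `(G, T)` is not a graft. -/
noncomputable def nu (G : Graph α β) (T : Set α) : ℕ∞ :=
  ⨅ F ∈ {F : Set β | IsJoin G T F}, F.encard

/-- `x` and `y` lie in the same connected component of `G` (for `x ∈ V(G)`). -/
def Reachable (G : Graph α β) (x y : α) : Prop :=
  Relation.ReflTransGen G.Adj x y

/-- `(G, T)` is a graft: `T ⊆ V(G)`, and every connected component of `G` contains an even number
of members of `T`. -/
def IsGraft (G : Graph α β) (T : Set α) : Prop :=
  T ⊆ V(G) ∧ ∀ x ∈ V(G), Even {y ∈ T | Reachable G x y}.ncard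

/-! ### Bipartite grafts with an ordered bipartition -/

variable (α β) in
/-- A quadruple `(G, T; A, B)`, so far without any condition. -/
structure Quad where
  /-- the graph `G` -/
  G : Graph α β
  /-- the vertex set `T` -/
  T : Set α
  /-- the first class -/
  A : Set α
  /-- the second class -/
  B : Set α

/-- `(G, T; A, B)` is a bipartite graft with an ordered bipartition: `(G, T)` is a finite graft and
`A`, `B` are color classes of `G`. -/
structure Quad.IsBipartiteGraft (Q : Quad α β) : Prop where
  finite_vertexSet : V(Q.G).Finite
  finite_edgeSet : E(Q.G).Finite
  isGraft : IsGraft Q.G Q.T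
  disjoint : Disjoint Q.A Q.B
  union_eq : Q.A ∪ Q.B = V(Q.G)
  /-- every edge joins a vertex of `A` and a vertex of `B` -/
  bipartite : ∀ e ∈ E(Q.G), ∃ a ∈ Q.A, ∃ b ∈ Q.B, Q.G.IsLink e a b

/-- `(G, T; A, B)` is a critical quasicomb (that is, a critical bipartite graft) with root `r`.
As `nu` is `⊤` for pairs without a join, the two equations include the claim that
`(G, T ∆ {x, r})` has a join. -/
structure Quad.IsCriticalQuasicomb (Q : Quad α β) (r : α) : Prop where
  isBipartiteGraft : Q.IsBipartiteGraft
  root_mem : r ∈ Q.B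
  nu_left : ∀ x ∈ Q.A, nu Q.G (Q.T ∆ {x, r}) = nu Q.G Q.T + 1
  nu_right : ∀ x ∈ Q.B, x ≠ r → nu Q.G (Q.T ∆ {x, r}) = nu Q.G Q.T

/-- The sum `G₁ + G₂` of two graphs in which common edges have the same ends. -/
def graphSum (G₁ G₂ : Graph α β) (h : G₁.Compatible G₂) : Graph α β where
  vertexSet := V(G₁) ∪ V(G₂)
  edgeSet := E(G₁) ∪ E(G₂)
  IsLink e x y := G₁.IsLink e x y ∨ G₂.IsLink e x y
  isLink_symm := fun _ _ => ⟨fun _ _ hl => hl.imp (fun k => k.symm) (fun k => k.symm)⟩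
  eq_or_eq_of_isLink_of_isLink := by
    rintro e x y v w (h₁ | h₁) (h₂ | h₂)
    · exact h₁.left_eq_or_eq h₂
    · exact (h₁.of_compatible h h₂.edge_mem).left_eq_or_eq h₂
    · exact h₁.left_eq_or_eq (h₂.of_compatible h h₁.edge_mem)
    · exact h₁.left_eq_or_eq h₂
  edge_mem_iff_exists_isLink := by
    intro e
    constructor
    · rintro (he | he)
      · obtain ⟨x, y, hl⟩ := Graph.exists_isLink_of_mem_edgeSet he
        exact ⟨x, y, Or.inl hl⟩
      · obtain ⟨x, y, hl⟩ := Graph.exists_isLink_of_mem_edgeSet he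
        exact ⟨x, y, Or.inr hl⟩
    · rintro ⟨x, y, hl | hl⟩
      · exact Or.inl hl.edge_mem
      · exact Or.inr hl.edge_mem
  left_mem_of_isLink := by
    rintro e x y (hl | hl)
    · exact Or.inl hl.left_mem
    · exact Or.inr hl.left_mem

/-- The sum `(G₁ + G₂, T₁ ∆ T₂; A₁ ∪ A₂, B₁ ∪ B₂)`. -/
def Quad.sum (Q₁ Q₂ : Quad α β) (h : Q₁.G.Compatible Q₂.G) : Quad α β where
  G := graphSum Q₁.G Q₂.G h
  T := Q₁.T ∆ Q₂.T
  A := Q₁.A ∪ Q₂.A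
  B := Q₁.B ∪ Q₂.B

/-- The graft `(({r}, ∅), ∅; ∅, {r})`. -/
def Quad.single (β : Type*) (r : α) : Quad α β where
  G := Graph.noEdge {r} β
  T := ∅
  A := ∅
  B := {r}

/-! ### Paths, circuits and ears -/

/-- The graph `P` is a path with ends `x` and `y`: its vertices are the distinct vertices
`v 0 = x, v 1, …, v n = y`, and its edges are `e 0, …, e (n - 1)`, where `e i` joins `v i` and
`v (i + 1)`. -/
def IsPathBetween (P : Graph α β) (x y : α) : Prop :=
  ∃ (n : ℕ) (v : ℕ → α) (e : ℕ → β),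
    v 0 = x ∧ v n = y ∧ Set.InjOn v (Set.Iic n) ∧
    (∀ i < n, P.IsLink (e i) (v i) (v (i + 1))) ∧
    V(P) = v '' Set.Iic n ∧ E(P) = e '' Set.Iio n

/-- The graph `P` is a circuit: its vertices are the distinct vertices `v 0, …, v (n - 1)` with
`1 ≤ n`, and its edges are the distinct edges `e 0, …, e (n - 1)`, where `e i` joins `v i` and
`v (i + 1)`, and `v n = v 0`. -/
def IsCircuit (P : Graph α β) : Prop :=
  ∃ (n : ℕ) (v : ℕ → α) (e : ℕ → β),
    1 ≤ n ∧ v n = v 0 ∧ Set.InjOn v (Set.Iio n) ∧ Set.InjOn e (Set.Iio n) ∧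
    (∀ i < n, P.IsLink (e i) (v i) (v (i + 1))) ∧
    V(P) = v '' Set.Iio n ∧ E(P) = e '' Set.Iio n

/-- `P` is a round ear relative to `X`: a path with at least one edge whose two ends, and no other
vertices, are in `X`, or a circuit that shares exactly one vertex with `X`. -/
def IsRoundEar (P : Graph α β) (X : Set α) : Prop :=
  E(P).Nonempty ∧
    ((∃ s t, IsPathBetween P s t ∧ V(P) ∩ X = {s, t}) ∨
      (IsCircuit P ∧ ∃ s, V(P) ∩ X = {s}))

/-- `P` is a straight ear relative to `X` with bond `s` and other end `v`: a path with at least one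
edge and ends `s`, `v`, of which `s` is the only vertex shared with `X`. -/
def IsStraightEar (P : Graph α β) (X : Set α) (s v : α) : Prop :=
  E(P).Nonempty ∧ IsPathBetween P s v ∧ V(P) ∩ X = {s}

/-- The ear graft `R = (P, T'; A', B')` is effective relative to `Q = (G, T; A, B)`. The bonds of
the ear are the members of `V(P) ∩ V(G)`. -/
structure Quad.IsEffectiveEarGraft (Q R : Quad α β) : Prop where
  isBipartiteGraft : R.IsBipartiteGraft
  /-- `G` and `P` are subgraphs of a common graph -/
  compatible : Q.G.Compatible R.G
  disjoint_left : Disjoint Q.A R.B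
  disjoint_right : Disjoint R.A Q.B
  isEar : IsRoundEar R.G V(Q.G) ∨ ∃ s v, IsStraightEar R.G V(Q.G) s v
  /-- vertices of `B'` other than bonds are in `T'` -/
  nonbond : (V(R.G) \ V(Q.G)) ∩ R.B ⊆ R.T
  /-- bonds in `B'` are not in `T'` -/
  bond : (V(R.G) ∩ V(Q.G)) ∩ R.B ∩ R.T = ∅
  /-- conditions on a straight ear with bond `s` and other end `v` -/
  straight : ∀ s v, IsStraightEar R.G V(Q.G) s v →
    v ∉ R.A ∩ R.T ∧ s ∉ R.A \ R.T ∧ V(R.G) \ {s, v} ⊆ R.T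

/-- The family `𝒞(r)`, generated from the single vertex `r` by adding effective ear grafts. -/
inductive CriticalFamily (r : α) : Quad α β → Prop
  | single : CriticalFamily r (Quad.single β r)
  | add (Q R : Quad α β) (hQ : CriticalFamily r Q) (hR : Q.IsEffectiveEarGraft R) :
      CriticalFamily r (Q.sum R hR.compatible)

end

end BipGraft

open scoped symmDiff

namespace BipGraft

open Graph

section

variable {α β : Type*}

/-! ### Parity of joins -/

/-! Every edge has exactly one end in `B`, and every vertex of `T ∩ B` meets an edge of each join.
So a join of `(G, T)` has at least `|T ∩ B|` edges, with equality exactly when it is thin: no vertex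
of `B` meets two of its edges. Both directions of the theorem pass through `Quad.HasThinJoins`: `T ∩
B = B \ {r}`, and every `(G, T ∆ {x, r})` with `x ∈ V(G)` has a thin join. Thin joins are minimum,
so counting `T ∩ B` gives the prescribed values of `ν`. Conversely, in a critical quasicomb a
minimum join for `b ∈ B` has no edge at `b`, since deleting one would leave too small a join for its
other end. This determines `T ∩ B`. Exchanging minimum joins for `r` and `b` along a path of their
symmetric difference shows that a minimum join of `(G, T)` is thin
(`Quad.IsCriticalQuasicomb.hasThinJoins`). This fixes `|B|`, and thinness of the other minimum joins
follows by counting. Ears preserve the property: an effective ear graft has a thin join, and also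
thin joins that move the odd end from any new vertex to some bond. These add up with thin joins of
the old graft, because at a shared vertex of `B` at most one summand has an edge
(`Quad.IsEffectiveEarGraft.exists_thin`, `IsThin.graphSum`). To decompose, fix a thin join `F` of
`(G, T)` and grow a subgraph `H` from `r` that contains the `F`-edge, if any, at each of its
vertices in `B`. If an edge leaving `H` is not itself an effective ear, then it enters some `y ∈ B`
outside `H` without belonging to `F`. A path from `y` to `r` in the symmetric difference of `F` and
a thin join for `y`, cut at its first vertex in `H`, completes it to a round ear
(`Quad.IsGrown.exists_larger`). -/

lemma odd_ncard_symmDiff {γ : Type*} {S T : Set γ} (hS : S.Finite) (hT : T.Finite) :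
    Odd (S ∆ T).ncard ↔ ¬ (Odd S.ncard ↔ Odd T.ncard) := by
  have h1 : (S ∆ T).ncard = (S \ T).ncard + (T \ S).ncard := by
    rw [Set.symmDiff_def]
    exact Set.ncard_union_eq disjoint_sdiff_sdiff (hS.subset Set.sdiff_subset)
      (hT.subset Set.sdiff_subset)
  have h2 := Set.ncard_inter_add_ncard_sdiff_eq_ncard S T hS
  have h3 := Set.ncard_inter_add_ncard_sdiff_eq_ncard T S hT
  rw [Set.inter_comm] at h3
  simp only [Nat.odd_iff]
  omega

lemma odd_ncard_iff_nonempty {γ : Type*} {S : Set γ} (hS : S.Subsingleton) :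
    Odd S.ncard ↔ S.Nonempty := by
  rcases hS.eq_empty_or_singleton with rfl | ⟨a, rfl⟩ <;> simp

lemma sep_symmDiff {γ : Type*} (S T : Set γ) (p : γ → Prop) :
    {x ∈ S ∆ T | p x} = {x ∈ S | p x} ∆ {x ∈ T | p x} := by
  ext x
  simp only [Set.mem_symmDiff, Set.mem_ofPred_eq]
  tauto

lemma IsJoin.symmDiff {G : Graph α β} {T T' : Set α} {F F' : Set β} (hE : E(G).Finite)
    (h : IsJoin G T F) (h' : IsJoin G T' F') : IsJoin G (T ∆ T') (F ∆ F') := by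
  refine ⟨?_, fun v hv => ?_⟩
  · intro e he
    rcases he with he | he
    · exact h.1 he.1
    · exact h'.1 he.1
  · rw [sep_symmDiff, odd_ncard_symmDiff ((hE.subset h.1).subset (Set.sep_subset _ _))
      ((hE.subset h'.1).subset (Set.sep_subset _ _)), h.2 v hv, h'.2 v hv, Set.mem_symmDiff]
    tauto

lemma isNonloopAt_iff_of_isLink {G : Graph α β} {e : β} {x y : α} (h : G.IsLink e x y) (v : α) :
    G.IsNonloopAt e v ↔ v ∈ ({x} ∆ {y} : Set α) := by
  simp only [Set.mem_symmDiff, Set.mem_singleton_iff]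
  constructor
  · rintro ⟨w, hw, hl⟩
    rcases h.eq_and_eq_or_eq_and_eq hl with ⟨rfl, rfl⟩ | ⟨rfl, rfl⟩ <;> grind
  · rintro (⟨rfl, hne⟩ | ⟨rfl, hne⟩)
    · exact ⟨y, Ne.symm hne, h⟩
    · exact ⟨x, Ne.symm hne, h.symm⟩

lemma isJoin_empty (G : Graph α β) : IsJoin G ∅ ∅ := by
  refine ⟨Set.empty_subset _, fun v _ => ?_⟩
  simp

lemma isJoin_singleton {G : Graph α β} {e : β} {x y : α} (h : G.IsLink e x y) :
    IsJoin G ({x} ∆ {y}) {e} := by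
  refine ⟨Set.singleton_subset_iff.2 h.edge_mem, fun v _ => ?_⟩
  rw [← isNonloopAt_iff_of_isLink h v, odd_ncard_iff_nonempty]
  · constructor
    · rintro ⟨f, hf, hn⟩
      rwa [← Set.mem_singleton_iff.1 hf]
    · exact fun hn => ⟨e, rfl, hn⟩
  · exact Set.subsingleton_singleton.anti (Set.sep_subset _ _)

/-- The inclusions in `V(G)` are needed because a join constrains `T` only at vertices of `G`. -/
lemma IsJoin.eq_of_subset {G : Graph α β} {T T' : Set α} {F : Set β} (h : IsJoin G T F)
    (h' : IsJoin G T' F) (hT : T ⊆ V(G)) (hT' : T' ⊆ V(G)) : T = T' := by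
  ext v
  constructor
  · exact fun hv => (h'.2 v (hT hv)).1 ((h.2 v (hT hv)).2 hv)
  · exact fun hv => (h.2 v (hT' hv)).1 ((h'.2 v (hT' hv)).2 hv)

lemma IsJoin.mem_iff_of_subsingleton {G : Graph α β} {T : Set α} {F : Set β} (h : IsJoin G T F)
    {v : α} (hv : v ∈ V(G)) (hs : {e ∈ F | G.IsNonloopAt e v}.Subsingleton) :
    v ∈ T ↔ ∃ e ∈ F, G.IsNonloopAt e v := by
  rw [← h.2 v hv, odd_ncard_iff_nonempty hs]
  rfl

lemma IsJoin.exists_of_mem {G : Graph α β} {T : Set α} {F : Set β} (h : IsJoin G T F)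
    {v : α} (hv : v ∈ V(G)) (hT : v ∈ T) : ∃ e ∈ F, G.IsNonloopAt e v := by
  have := (h.2 v hv).2 hT
  by_contra hc
  have h0 : {e ∈ F | G.IsNonloopAt e v} = ∅ := by
    ext e
    simp only [Set.mem_ofPred_eq, Set.mem_empty_iff_false, iff_false]
    exact fun he => hc ⟨e, he⟩
  rw [h0] at this
  simp at this

/-! ### Joins and grafts -/

lemma IsGraft.symmDiff {G : Graph α β} {T T' : Set α} (hV : V(G).Finite)
    (h : IsGraft G T) (h' : IsGraft G T') : IsGraft G (T ∆ T') := by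
  refine ⟨?_, fun x hx => ?_⟩
  · intro e he
    rcases he with he | he
    · exact h.1 he.1
    · exact h'.1 he.1
  · rw [← Nat.not_odd_iff_even, sep_symmDiff,
      odd_ncard_symmDiff ((hV.subset h.1).subset (Set.sep_subset _ _))
        ((hV.subset h'.1).subset (Set.sep_subset _ _)),
      ← Nat.not_even_iff_odd, ← Nat.not_even_iff_odd]
    simp [h.2 x hx, h'.2 x hx]

lemma isGraft_pair {G : Graph α β} {x y : α} (hx : x ∈ V(G)) (hy : y ∈ V(G))
    (h : Reachable G x y) : IsGraft G ({x} ∆ {y}) := by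
  by_cases hxy : x = y
  · subst hxy
    refine ⟨by simp, fun z _ => by simp⟩
  refine ⟨?_, fun z _ => ?_⟩
  · rintro z (⟨rfl, _⟩ | ⟨rfl, _⟩) <;> assumption
  · have hr : Reachable G z x ↔ Reachable G z y := by
      refine ⟨fun hz => hz.trans h, fun hz => hz.trans ?_⟩
      exact (Relation.ReflTransGen.stdSymm (r := G.Adj)).symm _ _ h
    by_cases hz : Reachable G z x
    · have : {w ∈ ({x} ∆ {y} : Set α) | Reachable G z w} = {x, y} := by
        ext w
        simp only [Set.mem_symmDiff, Set.mem_singleton_iff, Set.mem_ofPred_eq, Set.mem_insert_iff]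
        constructor
        · tauto
        · rintro (rfl | rfl)
          · exact ⟨Or.inl ⟨rfl, hxy⟩, hz⟩
          · exact ⟨Or.inr ⟨rfl, Ne.symm hxy⟩, hr.1 hz⟩
      rw [this, Set.ncard_pair hxy]
      exact even_two
    · have : {w ∈ ({x} ∆ {y} : Set α) | Reachable G z w} = ∅ := by
        ext w
        simp only [Set.mem_symmDiff, Set.mem_singleton_iff, Set.mem_ofPred_eq,
          Set.mem_empty_iff_false, iff_false]
        rintro ⟨⟨rfl, _⟩ | ⟨rfl, _⟩, hw⟩
        · exact hz hw
        · exact hz (hr.2 hw)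
      rw [this]
      simp

/-- Deleting an edge of `F` toggles its two ends, which lie in one component, so parities of
components are unchanged; induction on `F`. -/
lemma IsJoin.isGraft {G : Graph α β} {T : Set α} {F : Set β} (hV : V(G).Finite)
    (hE : E(G).Finite) (hT : T ⊆ V(G)) (h : IsJoin G T F) : IsGraft G T := by
  have hF : F.Finite := hE.subset h.1
  induction F, hF using Set.Finite.induction_on generalizing T with
  | empty =>
    have : T = ∅ := h.eq_of_subset (isJoin_empty G) hT (Set.empty_subset _)
    subst this
    exact ⟨hT, fun _ _ => by simp⟩
  | @insert e F he _ ih =>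
    obtain ⟨x, y, hl⟩ := exists_isLink_of_mem_edgeSet (h.1 (Set.mem_insert e F))
    have hp := isGraft_pair hl.left_mem hl.right_mem (Relation.ReflTransGen.single hl.adj)
    have hF' : insert e F ∆ {e} = F := by
      ext f
      simp only [Set.mem_symmDiff, Set.mem_insert_iff, Set.mem_singleton_iff]
      grind
    have hj := h.symmDiff hE (isJoin_singleton hl)
    rw [hF'] at hj
    have hT' : T ∆ ({x} ∆ {y}) ⊆ V(G) := by
      rintro z (hz | hz)
      · exact hT hz.1
      · exact hp.1 hz.1
    have := (ih hT' hj).symmDiff hV hp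
    rwa [symmDiff_symmDiff_cancel_right] at this

lemma exists_isJoin_of_reachable {G : Graph α β} {x y : α} (hE : E(G).Finite)
    (h : Reachable G x y) : ∃ F, IsJoin G ({x} ∆ {y}) F := by
  induction h with
  | refl => exact ⟨∅, by simpa using isJoin_empty G⟩
  | @tail y z _ hyz ih =>
    obtain ⟨F, hF⟩ := ih
    obtain ⟨e, he⟩ := hyz
    refine ⟨F ∆ {e}, ?_⟩
    have := hF.symmDiff hE (isJoin_singleton he)
    rwa [symmDiff_assoc, symmDiff_symmDiff_cancel_left] at this

/-- A nonempty `T` has two members in one component. Removing both shrinks `T`, and a join for that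
pair is added back. -/
lemma IsGraft.exists_isJoin {G : Graph α β} {T : Set α} (hV : V(G).Finite)
    (hE : E(G).Finite) (h : IsGraft G T) : ∃ F, IsJoin G T F := by
  induction hn : T.ncard using Nat.strong_induction_on generalizing T with
  | _ n ih =>
    have hTf := hV.subset h.1
    rcases T.eq_empty_or_nonempty with rfl | ⟨x, hx⟩
    · exact ⟨∅, isJoin_empty G⟩
    · obtain ⟨y, hy, hyx, hr⟩ : ∃ y ∈ T, y ≠ x ∧ Reachable G x y := by
        by_contra hc
        push Not at hc
        have h1 : {y ∈ T | Reachable G x y} = {x} := by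
          ext y
          simp only [Set.mem_ofPred_eq, Set.mem_singleton_iff]
          constructor
          · intro hy
            by_contra hyx
            exact hc y hy.1 hyx hy.2
          · rintro rfl
            exact ⟨hx, Relation.ReflTransGen.refl⟩
        have := h.2 x (h.1 hx)
        rw [h1] at this
        simp at this
      have hg := h.symmDiff hV (isGraft_pair (h.1 hx) (h.1 hy) hr)
      have hlt : (T ∆ ({x} ∆ {y})).ncard < n := by
        rw [← hn]
        apply Set.ncard_lt_ncard _ hTf
        refine ⟨?_, fun hs => ?_⟩
        · intro z hz
          simp only [Set.mem_symmDiff, Set.mem_singleton_iff] at hz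
          grind
        · have := hs hx
          simp only [Set.mem_symmDiff, Set.mem_singleton_iff] at this
          grind
      obtain ⟨F, hF⟩ := ih _ hlt hg rfl
      obtain ⟨F', hF'⟩ := exists_isJoin_of_reachable hE hr
      refine ⟨F ∆ F', ?_⟩
      have := hF.symmDiff hE hF'
      rwa [symmDiff_symmDiff_cancel_right] at this

/-! ### Paths in joins -/

/-- Leave `x` by an edge of `J`; the rest of `J` is a smaller join for the new vertex and `y`, which
gives a path by induction. -/
lemma IsJoin.exists_path {G : Graph α β} {x y : α} {J : Set β} (hE : E(G).Finite)
    (hx : x ∈ V(G)) (hxy : x ≠ y) (h : IsJoin G ({x} ∆ {y}) J) :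
    ∃ (n : ℕ) (v : ℕ → α) (e : ℕ → β), v 0 = x ∧ v n = y ∧ Set.InjOn v (Set.Iic n) ∧
      ∀ i < n, e i ∈ J ∧ G.IsLink (e i) (v i) (v (i + 1)) := by
  induction hn : J.ncard using Nat.strong_induction_on generalizing J x with
  | _ m ih =>
    have hJ : J.Finite := hE.subset h.1
    obtain ⟨f, hfJ, z, hzx, hl⟩ := h.exists_of_mem hx (by simp [Set.mem_symmDiff, hxy])
    by_cases hzy : z = y
    · subst hzy
      refine ⟨1, fun i => if i = 0 then x else z, fun _ => f, by simp, by simp, ?_, ?_⟩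
      · intro i hi j hj hij
        simp only [Set.mem_Iic] at hi hj
        grind
      · intro i hi
        obtain rfl : i = 0 := by omega
        simpa using ⟨hfJ, hl⟩
    · have hj := h.symmDiff hE (isJoin_singleton hl)
      rw [symmDiff_comm ({x} : Set α) {y}, symmDiff_assoc, symmDiff_symmDiff_cancel_left,
        symmDiff_comm ({y} : Set α)] at hj
      have hsub : J ∆ {f} ⊆ J \ {f} := by
        rintro e (he | he)
        · exact he
        · exact absurd (he.1 ▸ hfJ) he.2
      have hlt : (J ∆ {f}).ncard < m := by
        rw [← hn]
        refine (Set.ncard_le_ncard hsub (hJ.subset Set.sdiff_subset)).trans_lt ?_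
        exact Set.ncard_sdiff_singleton_lt_of_mem hfJ hJ
      obtain ⟨n, v, e, h0, hvn, hinj, hlink⟩ := ih _ hlt hl.right_mem hzy hj rfl
      -- If the inductive path returns to `x`, its tail from there already suffices; otherwise `x`
      -- is put in front.
      by_cases hk : ∃ k ≤ n, v k = x
      · obtain ⟨k, hkn, hk⟩ := hk
        refine ⟨n - k, fun i => v (k + i), fun i => e (k + i), by simpa using hk, ?_, ?_, ?_⟩
        · simpa [Nat.add_sub_cancel' hkn] using hvn
        · intro i hi j hj' hij
          simp only [Set.mem_Iic] at hi hj'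
          have := hinj (show k + i ∈ Set.Iic n by simp; omega)
            (show k + j ∈ Set.Iic n by simp; omega) hij
          omega
        · intro i hi
          have := hlink (k + i) (by omega)
          exact ⟨(hsub this.1).1, this.2⟩
      · push Not at hk
        refine ⟨n + 1, fun i => if i = 0 then x else v (i - 1),
          fun i => if i = 0 then f else e (i - 1), by simp, by simpa using hvn, ?_, ?_⟩
        · intro i hi j hj' hij
          simp only [Set.mem_Iic] at hi hj'
          rcases Nat.eq_zero_or_pos i with rfl | hi0 <;> rcases Nat.eq_zero_or_pos j with rfl | hj0
          · rfl
          · simp only [if_true, hj0.ne', if_false] at hij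
            exact absurd hij.symm (hk _ (by omega))
          · simp only [if_true, hi0.ne', if_false] at hij
            exact absurd hij (hk _ (by omega))
          · simp only [hi0.ne', hj0.ne', if_false] at hij
            have := hinj (show i - 1 ∈ Set.Iic n by simp; omega)
              (show j - 1 ∈ Set.Iic n by simp; omega) hij
            omega
        · intro i hi
          rcases i with _ | i
          · simpa [h0] using ⟨hfJ, hl⟩
          · have := hlink i (by omega)
            simpa using ⟨(hsub this.1).1, this.2⟩

lemma injOn_edges_of_path {G : Graph α β} {n : ℕ} {v : ℕ → α} {e : ℕ → β}
    (hv : Set.InjOn v (Set.Iic n)) (hl : ∀ i < n, G.IsLink (e i) (v i) (v (i + 1))) :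
    Set.InjOn e (Set.Iio n) := by
  intro i hi j hj hij
  simp only [Set.mem_Iio] at hi hj
  have h := hl i hi
  rw [hij] at h
  have key : ∀ a b, a ≤ n → b ≤ n → v a = v b → a = b := fun a b ha hb => hv ha hb
  rcases h.eq_and_eq_or_eq_and_eq (hl j hj) with ⟨h1, _⟩ | ⟨h1, h2⟩
  · exact key _ _ hi.le hj.le h1
  · have := key _ _ hi.le hj h1
    have := key _ _ hi hj.le h2
    omega

lemma isJoin_segment {G : Graph α β} (hE : E(G).Finite) {n : ℕ} {v : ℕ → α} {e : ℕ → β}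
    (he : Set.InjOn e (Set.Iio n)) (hl : ∀ i < n, G.IsLink (e i) (v i) (v (i + 1)))
    {k m : ℕ} (hkm : k ≤ m) (hm : m ≤ n) : IsJoin G ({v k} ∆ {v m}) (e '' Set.Ico k m) := by
  induction m, hkm using Nat.le_induction with
  | base => simpa using isJoin_empty G
  | succ m hkm ih =>
    have h := (ih (by omega)).symmDiff hE (isJoin_singleton (hl m (by omega)))
    have hs : (e '' Set.Ico k m) ∆ {e m} = e '' Set.Ico k (m + 1) := by
      have hnot : e m ∉ e '' Set.Ico k m := by
        rintro ⟨i, hi, hie⟩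
        simp only [Set.mem_Ico] at hi
        have := he (show i ∈ Set.Iio n by simp; omega) (show m ∈ Set.Iio n by simp; omega) hie
        omega
      ext f
      simp only [Set.mem_symmDiff, Set.mem_singleton_iff]
      constructor
      · rintro (⟨⟨i, hi, rfl⟩, _⟩ | ⟨rfl, _⟩)
        · exact ⟨i, ⟨hi.1, hi.2.trans (Nat.lt_succ_self m)⟩, rfl⟩
        · exact ⟨m, ⟨hkm, Nat.lt_succ_self m⟩, rfl⟩
      · rintro ⟨i, ⟨hi1, hi2⟩, rfl⟩
        rcases (Nat.lt_succ_iff.1 hi2).lt_or_eq with hi | rfl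
        · have hmem : e i ∈ e '' Set.Ico k m := ⟨i, ⟨hi1, hi⟩, rfl⟩
          exact Or.inl ⟨hmem, fun h => hnot (h ▸ hmem)⟩
        · exact Or.inr ⟨rfl, hnot⟩
    rwa [hs, symmDiff_assoc, symmDiff_symmDiff_cancel_left] at h

/-! ### Thin joins -/

/-- Every vertex of `B` is incident with at most one edge of `F`. -/
def IsThin (G : Graph α β) (B : Set α) (F : Set β) : Prop :=
  ∀ b ∈ B, {e ∈ F | G.IsNonloopAt e b}.Subsingleton

/-- The combinatorial form of criticality: all vertices of `B` except for the root are in `T`, and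
`(G, T ∆ {x, r})` has a thin join for every vertex `x`. -/
structure Quad.HasThinJoins (Q : Quad α β) (r : α) : Prop where
  isBipartiteGraft : Q.IsBipartiteGraft
  root_mem : r ∈ Q.B
  mem_T_iff : ∀ b ∈ Q.B, b ∈ Q.T ↔ b ≠ r
  exists_thin : ∀ x ∈ V(Q.G), ∃ F, IsJoin Q.G (Q.T ∆ ({x} ∆ {r})) F ∧ IsThin Q.G Q.B F

/-! ### Counting the edges of a join by their ends in `B` -/

namespace Quad.IsBipartiteGraft

variable {Q : Quad α β}

lemma mem_vertexSet_left (h : Q.IsBipartiteGraft) {a : α} (ha : a ∈ Q.A) : a ∈ V(Q.G) :=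
  h.union_eq ▸ Or.inl ha

lemma mem_vertexSet_right (h : Q.IsBipartiteGraft) {b : α} (hb : b ∈ Q.B) : b ∈ V(Q.G) :=
  h.union_eq ▸ Or.inr hb

lemma mem_or_mem (h : Q.IsBipartiteGraft) {x : α} (hx : x ∈ V(Q.G)) : x ∈ Q.A ∨ x ∈ Q.B := by
  rw [← h.union_eq] at hx
  exact hx

lemma notMem_right (h : Q.IsBipartiteGraft) {a : α} (ha : a ∈ Q.A) : a ∉ Q.B :=
  fun hb => Set.disjoint_left.1 h.disjoint ha hb

lemma mem_left_iff_of_isLink (h : Q.IsBipartiteGraft) {e : β} {x y : α} (hl : Q.G.IsLink e x y) :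
    x ∈ Q.A ↔ y ∈ Q.B := by
  obtain ⟨a, ha, b, hb, hab⟩ := h.bipartite e hl.edge_mem
  have := h.notMem_right ha
  have h' : b ∉ Q.A := fun hc => h.notMem_right hc hb
  rcases hl.eq_and_eq_or_eq_and_eq hab with ⟨rfl, rfl⟩ | ⟨rfl, rfl⟩ <;> tauto

lemma ne_of_isLink (h : Q.IsBipartiteGraft) {e : β} {x y : α} (hl : Q.G.IsLink e x y) :
    x ≠ y := by
  rintro rfl
  have h1 := h.mem_left_iff_of_isLink hl
  rcases h.mem_or_mem hl.left_mem with hx | hx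
  · exact h.notMem_right hx (h1.1 hx)
  · exact h.notMem_right (h1.2 hx) hx

lemma isNonloopAt_of_isLink (h : Q.IsBipartiteGraft) {e : β} {x y : α} (hl : Q.G.IsLink e x y) :
    Q.G.IsNonloopAt e x :=
  ⟨y, (h.ne_of_isLink hl).symm, hl⟩

lemma exists_right_end (h : Q.IsBipartiteGraft) [Nonempty α] :
    ∃ g : β → α, ∀ e ∈ E(Q.G), g e ∈ Q.B ∧ ∀ b ∈ Q.B, Q.G.IsNonloopAt e b ↔ b = g e := by
  have : ∀ e, ∃ g : α, e ∈ E(Q.G) → g ∈ Q.B ∧ ∀ b ∈ Q.B, Q.G.IsNonloopAt e b ↔ b = g := by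
    intro e
    by_cases he : e ∈ E(Q.G)
    · obtain ⟨a, ha, b, hb, hab⟩ := h.bipartite e he
      refine ⟨b, fun _ => ⟨hb, fun b' hb' => ?_⟩⟩
      rw [isNonloopAt_iff_of_isLink hab, Set.mem_symmDiff, Set.mem_singleton_iff,
        Set.mem_singleton_iff]
      have h1 : b' ≠ a := fun hc => h.notMem_right ha (hc ▸ hb')
      tauto
    · exact ⟨Classical.arbitrary α, fun h => absurd h he⟩
  choose g hg using this
  exact ⟨g, hg⟩

lemma ncard_inter_le (h : Q.IsBipartiteGraft) {T : Set α} {F : Set β} (hF : IsJoin Q.G T F) :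
    (T ∩ Q.B).ncard ≤ F.ncard := by
  rcases isEmpty_or_nonempty α with _ | _
  · simp [Set.eq_empty_of_isEmpty]
  obtain ⟨g, hg⟩ := h.exists_right_end
  have hFf := h.finite_edgeSet.subset hF.1
  refine (Set.ncard_le_ncard (t := g '' F) ?_ (hFf.image g)).trans (Set.ncard_image_le hFf)
  rintro b ⟨hbT, hbB⟩
  obtain ⟨e, he, hn⟩ := hF.exists_of_mem (h.mem_vertexSet_right hbB) hbT
  exact ⟨e, he, (((hg e (hF.1 he)).2 b hbB).1 hn).symm⟩

/-- The map sending an edge of `F` to its end in `B` covers `T ∩ B`. Thinness makes it injective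
with image exactly `T ∩ B`; conversely, equal cardinalities force injectivity. -/
lemma isThin_iff (h : Q.IsBipartiteGraft) {T : Set α} {F : Set β} (hF : IsJoin Q.G T F) :
    IsThin Q.G Q.B F ↔ F.ncard = (T ∩ Q.B).ncard := by
  rcases isEmpty_or_nonempty α with _ | _
  · have : F = ∅ := by
      ext e
      simp only [Set.mem_empty_iff_false, iff_false]
      intro he
      obtain ⟨x, -⟩ := exists_isLink_of_mem_edgeSet (hF.1 he)
      exact isEmptyElim x
    subst this
    simp [IsThin, Set.eq_empty_of_isEmpty]
  obtain ⟨g, hg⟩ := h.exists_right_end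
  have hFf := h.finite_edgeSet.subset hF.1
  have hsub : T ∩ Q.B ⊆ g '' F := by
    rintro b ⟨hbT, hbB⟩
    obtain ⟨e, he, hn⟩ := hF.exists_of_mem (h.mem_vertexSet_right hbB) hbT
    exact ⟨e, he, (((hg e (hF.1 he)).2 b hbB).1 hn).symm⟩
  have hnl : ∀ e ∈ F, Q.G.IsNonloopAt e (g e) := fun e he =>
    ((hg e (hF.1 he)).2 _ (hg e (hF.1 he)).1).2 rfl
  constructor
  · intro ht
    have himg : g '' F = T ∩ Q.B := by
      refine Set.Subset.antisymm ?_ hsub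
      rintro _ ⟨e, he, rfl⟩
      have hb := (hg e (hF.1 he)).1
      exact ⟨(hF.mem_iff_of_subsingleton (h.mem_vertexSet_right hb) (ht _ hb)).2
        ⟨e, he, hnl e he⟩, hb⟩
    rw [← himg, Set.InjOn.ncard_image]
    intro e he f hf hef
    exact ht (g e) (hg e (hF.1 he)).1 ⟨he, hnl e he⟩ ⟨hf, hef ▸ hnl f hf⟩
  · intro hc
    have hle := Set.ncard_le_ncard hsub (hFf.image g)
    have hinj : Set.InjOn g F :=
      Set.injOn_of_ncard_image_eq (le_antisymm (Set.ncard_image_le hFf) (hc ▸ hle)) hFf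
    rintro b hb e ⟨he, hen⟩ f ⟨hf, hfn⟩
    exact hinj he hf ((((hg e (hF.1 he)).2 b hb).1 hen).symm.trans
      (((hg f (hF.1 hf)).2 b hb).1 hfn))

lemma nu_eq_of_isThin (h : Q.IsBipartiteGraft) {T : Set α} {F : Set β} (hF : IsJoin Q.G T F)
    (ht : IsThin Q.G Q.B F) : nu Q.G T = ((T ∩ Q.B).ncard : ℕ∞) := by
  apply le_antisymm
  · refine (iInf₂_le F hF).trans ?_
    rw [← (h.finite_edgeSet.subset hF.1).cast_ncard_eq, (h.isThin_iff hF).1 ht]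
  · refine le_iInf₂ fun F' hF' => ?_
    rw [← (h.finite_edgeSet.subset hF'.1).cast_ncard_eq]
    exact_mod_cast h.ncard_inter_le hF'

lemma exists_isJoin_nu (h : Q.IsBipartiteGraft) {T : Set α} (hT : nu Q.G T ≠ ⊤) :
    ∃ F, IsJoin Q.G T F ∧ (F.ncard : ℕ∞) = nu Q.G T := by
  have hne : Nonempty {F : Set β // IsJoin Q.G T F} := by
    by_contra hc
    apply hT
    simp only [nu, Set.mem_ofPred_eq, iInf_eq_top]
    exact fun F hF => absurd ⟨F, hF⟩ hc
  have hmem := ciInf_mem (fun F : {F : Set β // IsJoin Q.G T F} => F.1.encard)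
  obtain ⟨F, hF⟩ := hmem
  refine ⟨F.1, F.2, ?_⟩
  rw [(h.finite_edgeSet.subset F.2.1).cast_ncard_eq, nu]
  simp only at hF
  rw [hF, iInf_subtype]
  rfl

lemma nu_le (h : Q.IsBipartiteGraft) {T : Set α} {F : Set β} (hF : IsJoin Q.G T F) :
    nu Q.G T ≤ (F.ncard : ℕ∞) := by
  rw [(h.finite_edgeSet.subset hF.1).cast_ncard_eq]
  exact iInf₂_le F hF

end Quad.IsBipartiteGraft

/-! ### Criticality and thin joins -/

lemma symmDiff_pair_self (T : Set α) (r : α) : T ∆ ({r} ∆ {r}) = T := by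
  rw [symmDiff_self]
  exact symmDiff_bot T

lemma pair_eq_symmDiff {x r : α} (h : x ≠ r) : ({x, r} : Set α) = {x} ∆ {r} := by
  ext z
  simp only [Set.mem_insert_iff, Set.mem_singleton_iff, Set.mem_symmDiff]
  grind

lemma inter_right_of_mem_right {Q : Quad α β} {r x : α} (hT : ∀ b ∈ Q.B, b ∈ Q.T ↔ b ≠ r)
    (hx : x ∈ Q.B) : (Q.T ∆ ({x} ∆ {r})) ∩ Q.B = Q.B \ {x} := by
  ext z
  simp only [Set.mem_inter_iff, Set.mem_symmDiff, Set.mem_singleton_iff, Set.mem_sdiff]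
  grind

lemma inter_right_of_notMem_right {Q : Quad α β} {r x : α} (hT : ∀ b ∈ Q.B, b ∈ Q.T ↔ b ≠ r)
    (hx : x ∉ Q.B) : (Q.T ∆ ({x} ∆ {r})) ∩ Q.B = Q.B := by
  ext z
  simp only [Set.mem_inter_iff, Set.mem_symmDiff, Set.mem_singleton_iff]
  grind

theorem Quad.HasThinJoins.isCriticalQuasicomb {Q : Quad α β} {r : α} (h : Q.HasThinJoins r) :
    Q.IsCriticalQuasicomb r := by
  have hb := h.isBipartiteGraft
  have hBf : Q.B.Finite := hb.finite_vertexSet.subset fun b => hb.mem_vertexSet_right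
  have hnu : ∀ x ∈ V(Q.G), nu Q.G (Q.T ∆ ({x} ∆ {r})) =
      (((Q.T ∆ ({x} ∆ {r})) ∩ Q.B).ncard : ℕ∞) := by
    intro x hx
    obtain ⟨F, hF, ht⟩ := h.exists_thin x hx
    exact hb.nu_eq_of_isThin hF ht
  have h0 : nu Q.G Q.T = ((Q.B \ {r}).ncard : ℕ∞) := by
    have := hnu r (hb.mem_vertexSet_right h.root_mem)
    rw [inter_right_of_mem_right h.mem_T_iff h.root_mem] at this
    rwa [symmDiff_pair_self] at this
  refine ⟨hb, h.root_mem, fun x hx => ?_, fun x hx hxr => ?_⟩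
  · have hxB := hb.notMem_right hx
    have hxr : x ≠ r := fun hc => hxB (hc ▸ h.root_mem)
    rw [pair_eq_symmDiff hxr, hnu x (hb.mem_vertexSet_left hx),
      inter_right_of_notMem_right h.mem_T_iff hxB, h0]
    have := Set.ncard_sdiff_singleton_add_one h.root_mem hBf
    exact_mod_cast this.symm
  · rw [pair_eq_symmDiff hxr, hnu x (hb.mem_vertexSet_right hx),
      inter_right_of_mem_right h.mem_T_iff hx, h0]
    have h1 := Set.ncard_sdiff_singleton_add_one h.root_mem hBf
    have h2 := Set.ncard_sdiff_singleton_add_one hx hBf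
    exact_mod_cast (by omega)

/-- Every element of `D` lies in exactly one of `F`, `F'`, so toggling `D` in both sets merely moves
it to the other. -/
lemma ncard_symmDiff_add_ncard_symmDiff {γ : Type*} {F F' D : Set γ} (hF : F.Finite)
    (hF' : F'.Finite) (hD : D ⊆ F ∆ F') :
    (F ∆ D).ncard + (F' ∆ D).ncard = F.ncard + F'.ncard := by
  have hDf : D.Finite := (hF.symmDiff hF').subset hD
  have key : ∀ {F : Set γ}, F.Finite →
      (F ∆ D).ncard = (F \ D).ncard + (D \ F).ncard ∧
      (F ∩ D).ncard + (F \ D).ncard = F.ncard := fun {F} hF =>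
    ⟨by
      rw [Set.symmDiff_def]
      exact Set.ncard_union_eq disjoint_sdiff_sdiff (hF.subset Set.sdiff_subset)
        (hDf.subset Set.sdiff_subset), Set.ncard_inter_add_ncard_sdiff_eq_ncard F D hF⟩
  have h1 : D \ F = F' ∩ D := by
    ext x
    have := @hD x
    simp only [Set.mem_symmDiff, Set.mem_sdiff, Set.mem_inter_iff] at *
    tauto
  have h2 : D \ F' = F ∩ D := by
    ext x
    have := @hD x
    simp only [Set.mem_symmDiff, Set.mem_sdiff, Set.mem_inter_iff] at *
    tauto
  obtain ⟨k1, k2⟩ := key hF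
  obtain ⟨k3, k4⟩ := key hF'
  rw [h1] at k1
  rw [h2] at k3
  omega

theorem Quad.IsCriticalQuasicomb.hasThinJoins {Q : Quad α β} {r : α}
    (h : Q.IsCriticalQuasicomb r) : Q.HasThinJoins r := by
  have hb := h.isBipartiteGraft
  have hE := hb.finite_edgeSet
  have hBf : Q.B.Finite := hb.finite_vertexSet.subset fun b => hb.mem_vertexSet_right
  obtain ⟨m, hm⟩ : ∃ m : ℕ, nu Q.G Q.T = m := by
    obtain ⟨F, hF⟩ := hb.isGraft.exists_isJoin hb.finite_vertexSet hE
    exact ⟨_, (ENat.natCast_toNat (ne_top_of_le_ne_top (ENat.natCast_ne_top _) (hb.nu_le hF))).symm⟩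
  have hnuB : ∀ b ∈ Q.B, nu Q.G (Q.T ∆ ({b} ∆ {r})) = m := by
    intro b hbB
    by_cases hbr : b = r
    · subst hbr
      rwa [symmDiff_pair_self]
    · rw [← pair_eq_symmDiff hbr, h.nu_right b hbB hbr, hm]
  have hnuA : ∀ a ∈ Q.A, nu Q.G (Q.T ∆ ({a} ∆ {r})) = (m + 1 : ℕ) := by
    intro a ha
    have har : a ≠ r := fun hc => hb.notMem_right ha (hc ▸ h.root_mem)
    rw [← pair_eq_symmDiff har, h.nu_left a ha, hm]
    rfl
  have exB : ∀ b ∈ Q.B, ∃ F, IsJoin Q.G (Q.T ∆ ({b} ∆ {r})) F ∧ F.ncard = m := by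
    intro b hbB
    obtain ⟨F, hF, hc⟩ := hb.exists_isJoin_nu (T := Q.T ∆ ({b} ∆ {r})) (by simp [hnuB b hbB])
    rw [hnuB b hbB] at hc
    exact ⟨F, hF, by exact_mod_cast hc⟩
  have leB : ∀ b ∈ Q.B, ∀ F, IsJoin Q.G (Q.T ∆ ({b} ∆ {r})) F → m ≤ F.ncard := by
    intro b hbB F hF
    have := hb.nu_le hF
    rw [hnuB b hbB] at this
    exact_mod_cast this
  -- Deleting an edge `ba` from such an `F` gives a join for `a ∈ A` with at most `m` edges, whereas
  -- `m + 1` are required.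
  have noEdge : ∀ b ∈ Q.B, ∀ F, IsJoin Q.G (Q.T ∆ ({b} ∆ {r})) F → F.ncard = m →
      ∀ e ∈ F, ¬ Q.G.IsNonloopAt e b := by
    rintro b hbB F hF hFm e he ⟨a, -, hl⟩
    have haA : a ∈ Q.A := (hb.mem_left_iff_of_isLink hl.symm).2 hbB
    have hj := hF.symmDiff hE (isJoin_singleton hl)
    have hs : (Q.T ∆ ({b} ∆ {r})) ∆ ({b} ∆ {a}) = Q.T ∆ ({a} ∆ {r}) := by
      rw [symmDiff_assoc, symmDiff_comm ({b} : Set α) {r}, symmDiff_assoc,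
        symmDiff_symmDiff_cancel_left, symmDiff_comm ({r} : Set α)]
    rw [hs] at hj
    have hle := hb.nu_le hj
    rw [hnuA a haA] at hle
    have hle' : m + 1 ≤ (F ∆ {e}).ncard := by exact_mod_cast hle
    have hsub : F ∆ {e} ⊆ F := by
      rintro f (hf | hf)
      · exact hf.1
      · exact hf.1 ▸ he
    have := Set.ncard_le_ncard hsub (hE.subset hF.1)
    omega
  have hT : ∀ b ∈ Q.B, b ∈ Q.T ↔ b ≠ r := by
    intro b hbB
    obtain ⟨F, hF, hFm⟩ := exB b hbB
    have hn : b ∉ Q.T ∆ ({b} ∆ {r}) := fun hc => by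
      obtain ⟨e, he, hn⟩ := hF.exists_of_mem (hb.mem_vertexSet_right hbB) hc
      exact noEdge b hbB F hF hFm e he hn
    simp only [Set.mem_symmDiff, Set.mem_singleton_iff] at hn
    tauto
  obtain ⟨F, hF, hFm⟩ : ∃ F, IsJoin Q.G Q.T F ∧ F.ncard = m := by
    simpa only [symmDiff_pair_self] using exB r h.root_mem
  have hthin : IsThin Q.G Q.B F := by
    rintro b hbB e₁ ⟨he₁, hn₁⟩ e₂ ⟨he₂, hn₂⟩
    have hbr : b ≠ r := by
      rintro rfl
      exact noEdge b hbB F (by rwa [symmDiff_pair_self]) hFm e₁ he₁ hn₁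
    obtain ⟨F', hF', hFm'⟩ := exB b hbB
    have hJ := hF.symmDiff hE hF'
    rw [symmDiff_symmDiff_cancel_left] at hJ
    obtain ⟨n, v, e, h0, hvn, hinj, hlink⟩ := hJ.exists_path hE (hb.mem_vertexSet_right hbB) hbr
    have hD := isJoin_segment hE (injOn_edges_of_path hinj fun i hi => (hlink i hi).2)
      (fun i hi => (hlink i hi).2) (Nat.zero_le n) le_rfl
    rw [h0, hvn] at hD
    have hDsub : e '' Set.Ico 0 n ⊆ F ∆ F' := by
      rintro _ ⟨i, hi, rfl⟩
      exact (hlink i hi.2).1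
    -- Exchange along the path: `F ∆ D` is a join for `b` and `F' ∆ D` one for `r`. Both have at
    -- least `m` edges and together `2 * m`, so `F ∆ D` is minimum and has no edge at `b`. Hence all
    -- edges of `F` at `b` lie on the path, which has only its first edge there.
    have hsum := ncard_symmDiff_add_ncard_symmDiff (hE.subset hF.1) (hE.subset hF'.1) hDsub
    have hj1 := hF.symmDiff hE hD
    have hj2 := hF'.symmDiff hE hD
    rw [symmDiff_symmDiff_cancel_right] at hj2
    have hl1 := leB b hbB _ hj1
    have hl2 := leB r h.root_mem _ (by rwa [symmDiff_pair_self])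
    have hno := noEdge b hbB _ hj1 (by omega)
    have hmem : ∀ f ∈ F, Q.G.IsNonloopAt f b → f = e 0 := by
      intro f hf hfb
      have hfD : f ∈ e '' Set.Ico 0 n := by
        by_contra hc
        exact hno f (Or.inl ⟨hf, hc⟩) hfb
      obtain ⟨i, hi, rfl⟩ := hfD
      have hi' : i < n := hi.2
      rcases hfb.inc.eq_or_eq_of_isLink (hlink i hi').2 with hbi | hbi
      · rw [← h0] at hbi
        rw [hinj (show 0 ∈ Set.Iic n by simp) (show i ∈ Set.Iic n by simp; omega) hbi]
      · rw [← h0] at hbi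
        have := hinj (show 0 ∈ Set.Iic n by simp) (show i + 1 ∈ Set.Iic n by simp; omega) hbi
        omega
    rw [hmem e₁ he₁ hn₁, hmem e₂ he₂ hn₂]
  have hcard : m + 1 = Q.B.ncard := by
    rw [← Set.ncard_sdiff_singleton_add_one h.root_mem hBf, ← hFm, (hb.isThin_iff hF).1 hthin]
    have := inter_right_of_mem_right hT h.root_mem
    rw [symmDiff_pair_self] at this
    rw [this]
  refine ⟨hb, h.root_mem, hT, fun x hx => ?_⟩
  rcases hb.mem_or_mem hx with hxA | hxB
  · obtain ⟨F', hF', hc⟩ := hb.exists_isJoin_nu (T := Q.T ∆ ({x} ∆ {r}))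
      (by rw [hnuA x hxA]; exact ENat.natCast_ne_top _)
    rw [hnuA x hxA] at hc
    have hc' : F'.ncard = m + 1 := by exact_mod_cast hc
    refine ⟨F', hF', (hb.isThin_iff hF').2 ?_⟩
    rw [inter_right_of_notMem_right hT (hb.notMem_right hxA), hc', hcard]
  · obtain ⟨F', hF', hc⟩ := exB x hxB
    refine ⟨F', hF', (hb.isThin_iff hF').2 ?_⟩
    rw [inter_right_of_mem_right hT hxB, hc]
    have := Set.ncard_sdiff_singleton_add_one hxB hBf
    omega

/-! ### Thin joins of ears -/

lemma subsingleton_of_subset_pair_of_odd {γ : Type*} {S : Set γ} {a b : γ} (hS : S ⊆ {a, b})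
    (ho : Odd S.ncard) : S.Subsingleton := by
  by_cases hab : a ∈ S ∧ b ∈ S ∧ a ≠ b
  · obtain ⟨ha, hb, hne⟩ := hab
    have : S = {a, b} := Set.Subset.antisymm hS (by
      rintro x (rfl | rfl) <;> assumption)
    rw [this, Set.ncard_pair hne] at ho
    exact absurd ho (by decide)
  · intro x hx y hy
    have h1 := hS hx
    have h2 := hS hy
    simp only [Set.mem_insert_iff, Set.mem_singleton_iff] at h1 h2
    grind

lemma subsingleton_of_subset_pair_of_notMem {γ : Type*} {S : Set γ} {a b : γ} (hS : S ⊆ {a, b})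
    (ha : a ∉ S) : S.Subsingleton := by
  intro x hx y hy
  have h1 := hS hx
  have h2 := hS hy
  simp only [Set.mem_insert_iff, Set.mem_singleton_iff] at h1 h2
  grind

/-- Distinctness is required only of interior vertices against all others, so that `v 0 = v n` is
allowed and circuits are covered. -/
lemma eq_or_eq_of_isNonloopAt_interior {P : Graph α β} {n : ℕ} {v : ℕ → α} {e : ℕ → β}
    (hl : ∀ i < n, P.IsLink (e i) (v i) (v (i + 1))) (hE : E(P) = e '' Set.Iio n)
    (hv : ∀ i j, 0 < i → i < n → j ≤ n → v i = v j → i = j) {i : ℕ} (hi : 0 < i) (hin : i < n)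
    {f : β} (hf : P.IsNonloopAt f (v i)) : f = e (i - 1) ∨ f = e i := by
  have hfE := hf.edge_mem
  rw [hE] at hfE
  obtain ⟨j, hj, rfl⟩ := hfE
  have hj' : j < n := hj
  rcases hf.inc.eq_or_eq_of_isLink (hl j hj') with h | h
  · rw [hv i j hi hin hj'.le h]
    exact Or.inr rfl
  · have := hv i (j + 1) hi hin hj' h
    left
    congr 1
    omega

/-- An interior vertex of `B` has two ear edges and odd degree in the join, hence degree one, except
at the chosen `x = v i`. There it is enough that `e (i - 1)` be absent, and this decides the bond:
toggle the segment back to `v 0` if `J` contains `e (i - 1)`, and the segment on to `v n` otherwise.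
`hend` isolates what happens at the bonds, where paths and circuits differ. -/
lemma exists_thin_of_round {R : Quad α β} {X : Set α} {n : ℕ} {v : ℕ → α} {e : ℕ → β} {J : Set β}
    (hb : R.IsBipartiteGraft) (he : Set.InjOn e (Set.Iio n))
    (hl : ∀ i < n, R.G.IsLink (e i) (v i) (v (i + 1))) (hE : E(R.G) = e '' Set.Iio n)
    (hV : ∀ x ∈ V(R.G), ∃ i ≤ n, x = v i)
    (hv : ∀ i j, 0 < i → i < n → j ≤ n → v i = v j → i = j)
    (h0 : v 0 ∈ X) (hn : v n ∈ X) (hX : ∀ i, 0 < i → i < n → v i ∉ X)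
    (hT : (V(R.G) \ X) ∩ R.B ⊆ R.T) (hJ : IsJoin R.G R.T J)
    (hend : ∀ J', (J' = J ∨ ∃ i, 0 < i ∧ i < n ∧
      (J' = J ∆ (e '' Set.Ico 0 i) ∨ J' = J ∆ (e '' Set.Ico i n))) →
      ∀ b ∈ R.B, b = v 0 ∨ b = v n → {f ∈ J' | R.G.IsNonloopAt f b}.Subsingleton) :
    (∃ J, IsJoin R.G R.T J ∧ IsThin R.G R.B J) ∧
      ∀ x ∈ V(R.G) \ X, ∃ y ∈ V(R.G) ∩ X, ∃ J,
        IsJoin R.G (R.T ∆ ({x} ∆ {y})) J ∧ IsThin R.G R.B J := by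
  have hEf := hb.finite_edgeSet
  have hsub : ∀ {J' : Set β} {i : ℕ}, 0 < i → i < n →
      {f ∈ J' | R.G.IsNonloopAt f (v i)} ⊆ {e (i - 1), e i} := fun {J'} {i} hi hin f hf =>
    eq_or_eq_of_isNonloopAt_interior hl hE hv hi hin hf.2
  have hmemV : ∀ i, i ≤ n → 0 < n → v i ∈ V(R.G) := by
    intro i hi hn0
    rcases hi.lt_or_eq with h | rfl
    · exact (hl i h).left_mem
    · obtain ⟨k, rfl⟩ : ∃ k, i = k + 1 := ⟨i - 1, by omega⟩
      exact (hl k (by omega)).right_mem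
  constructor
  · refine ⟨J, hJ, fun b hbB => ?_⟩
    obtain ⟨i, hi, rfl⟩ := hV b (hb.mem_vertexSet_right hbB)
    rcases Nat.eq_zero_or_pos i with rfl | hi0
    · exact hend J (Or.inl rfl) _ hbB (Or.inl rfl)
    rcases hi.lt_or_eq with hin | rfl
    · have hbV := hb.mem_vertexSet_right hbB
      exact subsingleton_of_subset_pair_of_odd (hsub hi0 hin)
        ((hJ.2 _ hbV).2 (hT ⟨⟨hbV, hX i hi0 hin⟩, hbB⟩))
    · exact hend J (Or.inl rfl) _ hbB (Or.inr rfl)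
  · rintro x ⟨hxV, hxX⟩
    obtain ⟨i, hi, rfl⟩ := hV x hxV
    have hi0 : 0 < i := Nat.pos_of_ne_zero fun h => hxX (h ▸ h0)
    have hin : i < n := lt_of_le_of_ne hi fun h => hxX (h ▸ hn)
    have main : ∀ J' y, y ∈ X → IsJoin R.G (R.T ∆ ({v i} ∆ {y})) J' → e (i - 1) ∉ J' →
        (∀ b ∈ R.B, b = v 0 ∨ b = v n → {f ∈ J' | R.G.IsNonloopAt f b}.Subsingleton) →
        IsThin R.G R.B J' := by
      intro J' y hy hJ' hnot hends b hbB
      have hbV := hb.mem_vertexSet_right hbB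
      obtain ⟨j, hj, rfl⟩ := hV b hbV
      rcases Nat.eq_zero_or_pos j with rfl | hj0
      · exact hends _ hbB (Or.inl rfl)
      rcases hj.lt_or_eq with hjn | rfl
      · by_cases hji : j = i
        · subst hji
          exact subsingleton_of_subset_pair_of_notMem (hsub hj0 hjn) fun hc => hnot hc.1
        · refine subsingleton_of_subset_pair_of_odd (hsub hj0 hjn) ((hJ'.2 _ hbV).2 ?_)
          refine Or.inl ⟨hT ⟨⟨hbV, hX j hj0 hjn⟩, hbB⟩, ?_⟩
          rintro (hc | hc)
          · exact hji (hv j i hj0 hjn hi hc.1)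
          · exact hX j hj0 hjn (hc.1 ▸ hy)
      · exact hends _ hbB (Or.inr rfl)
    have hei : ∀ k m, e (i - 1) ∈ e '' Set.Ico k m → m ≤ n → k ≤ i - 1 ∧ i - 1 < m := by
      rintro k m ⟨j, hj, hje⟩ hm
      have hj1 : k ≤ j := hj.1
      have hj2 : j < m := hj.2
      have := he (show j ∈ Set.Iio n by simp; omega) (show i - 1 ∈ Set.Iio n by simp; omega) hje
      omega
    by_cases hmem : e (i - 1) ∈ J
    · have hJ' := hJ.symmDiff hEf (isJoin_segment hEf he hl (Nat.zero_le i) hi)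
      rw [symmDiff_comm ({v 0} : Set α)] at hJ'
      refine ⟨v 0, ⟨hmemV 0 (by omega) (by omega), h0⟩, _, hJ', main _ _ h0 hJ' ?_ ?_⟩
      · rintro (hc | hc)
        · exact hc.2 ⟨i - 1, ⟨Nat.zero_le _, by omega⟩, rfl⟩
        · exact hc.2 hmem
      · exact hend _ (Or.inr ⟨i, hi0, hin, Or.inl rfl⟩)
    · have hJ' := hJ.symmDiff hEf (isJoin_segment hEf he hl hi le_rfl)
      refine ⟨v n, ⟨hmemV n le_rfl (by omega), hn⟩, _, hJ', main _ _ hn hJ' ?_ ?_⟩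
      · rintro (hc | hc)
        · exact hmem hc.1
        · have := hei _ _ hc.1 le_rfl
          omega
      · exact hend _ (Or.inr ⟨i, hi0, hin, Or.inr rfl⟩)

lemma subsingleton_at_path_ends {P : Graph α β} {n : ℕ} {v : ℕ → α} {e : ℕ → β}
    (hv : Set.InjOn v (Set.Iic n)) (hl : ∀ i < n, P.IsLink (e i) (v i) (v (i + 1)))
    (hE : E(P) = e '' Set.Iio n) (J : Set β) {b : α} (hb : b = v 0 ∨ b = v n) :
    {f ∈ J | P.IsNonloopAt f b}.Subsingleton := by
  have key : ∀ a b, a ≤ n → b ≤ n → v a = v b → a = b := fun a b ha hb => hv ha hb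
  have h : ∃ c : ℕ, ∀ j < n, b = v j ∨ b = v (j + 1) → j = c := by
    rcases hb with rfl | rfl
    · refine ⟨0, fun j hj hinc => ?_⟩
      rcases hinc with h | h <;> have := key _ _ (by omega) (by omega) h <;> omega
    · refine ⟨n - 1, fun j hj hinc => ?_⟩
      rcases hinc with h | h <;> have := key _ _ (by omega) (by omega) h <;> omega
  obtain ⟨c, hc⟩ := h
  have hfc : ∀ f, P.IsNonloopAt f b → f = e c := by
    intro f hf
    have hfE := hf.edge_mem
    rw [hE] at hfE
    obtain ⟨j, hj, rfl⟩ := hfE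
    rw [hc j hj (hf.inc.eq_or_eq_of_isLink (hl j hj))]
  rintro f ⟨-, hf⟩ f' ⟨-, hf'⟩
  rw [hfc f hf, hfc f' hf']

/-- Shifting indices modulo `n` lets the circuit start at the bond. -/
lemma IsCircuit.exists_rotation {P : Graph α β} (h : IsCircuit P) {s : α} (hs : s ∈ V(P)) :
    ∃ (n : ℕ) (v : ℕ → α) (e : ℕ → β),
      1 ≤ n ∧ v 0 = s ∧ v n = v 0 ∧ Set.InjOn v (Set.Iio n) ∧ Set.InjOn e (Set.Iio n) ∧
      (∀ i < n, P.IsLink (e i) (v i) (v (i + 1))) ∧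
      V(P) = v '' Set.Iio n ∧ E(P) = e '' Set.Iio n := by
  obtain ⟨n, v, e, hn, hvn, hv, he, hl, hV, hE⟩ := h
  have hs' := hs
  rw [hV] at hs'
  obtain ⟨k, hk, rfl⟩ := hs'
  have hk' : k < n := hk
  have hmod : ∀ i, i < n → (i + k) % n < n := fun i _ => Nat.mod_lt _ (by omega)
  have hinj : ∀ i j, i < n → j < n → (i + k) % n = (j + k) % n → i = j := by
    intro i j hi hj hij
    have : i ≡ j [MOD n] := Nat.ModEq.add_right_cancel' k hij
    rwa [Nat.ModEq, Nat.mod_eq_of_lt hi, Nat.mod_eq_of_lt hj] at this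
  have hsurj : (fun i => (i + k) % n) '' Set.Iio n = Set.Iio n := by
    ext j
    constructor
    · rintro ⟨i, hi, rfl⟩
      exact hmod i hi
    · intro hj
      have hj' : j < n := hj
      refine ⟨(j + (n - k)) % n, Nat.mod_lt _ (by omega), ?_⟩
      simp only [Nat.mod_add_mod]
      rw [show j + (n - k) + k = j + n by omega, Nat.add_mod_right, Nat.mod_eq_of_lt hj']
  refine ⟨n, fun i => v ((i + k) % n), fun i => e ((i + k) % n), hn, ?_, ?_, ?_, ?_, ?_, ?_, ?_⟩
  · simp [Nat.mod_eq_of_lt hk']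
  · simp
  · intro i hi j hj hij
    exact hinj i j hi hj (hv (hmod i hi) (hmod j hj) hij)
  · intro i hi j hj hij
    exact hinj i j hi hj (he (hmod i hi) (hmod j hj) hij)
  · intro i hi
    have h1 := hl _ (hmod i hi)
    have h2 : v ((i + k) % n + 1) = v ((i + 1 + k) % n) := by
      have h3 : (i + 1 + k) % n = ((i + k) % n + 1) % n := by
        rw [Nat.mod_add_mod]
        congr 1
        omega
      rw [h3]
      rcases Nat.lt_or_ge ((i + k) % n + 1) n with h4 | h4
      · rw [Nat.mod_eq_of_lt h4]
      · have h5 : (i + k) % n + 1 = n := le_antisymm (hmod i hi) h4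
        rw [h5, Nat.mod_self, hvn]
    rw [h2] at h1
    exact h1
  · rw [hV, ← Set.image_image v (fun i => (i + k) % n), hsurj]
  · rw [hE, ← Set.image_image e (fun i => (i + k) % n), hsurj]

/-- Toggling the whole circuit if necessary, the join avoids `e 0`. If the bond lies in `B`, it is
not in `T'`, so parity excludes the other edge there too. -/
lemma exists_thin_of_circuit {R : Quad α β} {X : Set α} {s : α} (hb : R.IsBipartiteGraft)
    (hc : IsCircuit R.G) (hs : V(R.G) ∩ X = {s}) (hT : (V(R.G) \ X) ∩ R.B ⊆ R.T)
    (hbond : (V(R.G) ∩ X) ∩ R.B ∩ R.T = ∅) :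
    (∃ J, IsJoin R.G R.T J ∧ IsThin R.G R.B J) ∧
      ∀ x ∈ V(R.G) \ X, ∃ y ∈ V(R.G) ∩ X, ∃ J,
        IsJoin R.G (R.T ∆ ({x} ∆ {y})) J ∧ IsThin R.G R.B J := by
  have hEf := hb.finite_edgeSet
  have hsm : s ∈ V(R.G) ∩ X := hs ▸ Set.mem_singleton s
  obtain ⟨n, v, e, hn, h0, hvn, hv, he, hl, hV, hE⟩ := hc.exists_rotation hsm.1
  have hends : ∀ {J' : Set β}, {f ∈ J' | R.G.IsNonloopAt f s} ⊆ {e 0, e (n - 1)} := by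
    rintro J' f ⟨-, hf⟩
    have hfE := hf.edge_mem
    rw [hE] at hfE
    obtain ⟨j, hj, rfl⟩ := hfE
    have hj' : j < n := hj
    rcases hf.inc.eq_or_eq_of_isLink (hl j hj') with h | h
    · rw [← h0] at h
      left
      rw [hv (show 0 ∈ Set.Iio n by simp; omega) hj h]
    · right
      rw [← h0] at h
      by_cases hjn : j + 1 < n
      · have := hv (show 0 ∈ Set.Iio n by simp; omega) hjn h
        omega
      · rw [show j = n - 1 by omega]
        rfl
  obtain ⟨J, hJ, hJ0⟩ : ∃ J, IsJoin R.G R.T J ∧ e 0 ∉ J := by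
    obtain ⟨J, hJ⟩ := hb.isGraft.exists_isJoin hb.finite_vertexSet hEf
    by_cases hmem : e 0 ∈ J
    · refine ⟨J ∆ (e '' Set.Ico 0 n), ?_, ?_⟩
      · have := hJ.symmDiff hEf (isJoin_segment hEf he hl (Nat.zero_le n) le_rfl)
        rwa [hvn, symmDiff_pair_self] at this
      · rintro (hc | hc)
        · exact hc.2 ⟨0, ⟨le_rfl, by omega⟩, rfl⟩
        · exact hc.2 hmem
    · exact ⟨J, hJ, hmem⟩
  have hnln : R.G.IsNonloopAt (e (n - 1)) s := by
    have h1 := hl (n - 1) (by omega)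
    rw [show n - 1 + 1 = n by omega, hvn, h0] at h1
    exact hb.isNonloopAt_of_isLink h1.symm
  have hthin : {f ∈ J | R.G.IsNonloopAt f s}.Subsingleton :=
    subsingleton_of_subset_pair_of_notMem hends fun h => hJ0 h.1
  refine exists_thin_of_round (X := X) hb he hl hE ?_ ?_ (h0 ▸ hsm.2) (hvn ▸ h0 ▸ hsm.2) ?_ hT
    hJ ?_
  · intro x hx
    rw [hV] at hx
    obtain ⟨i, hi, rfl⟩ := hx
    exact ⟨i, le_of_lt hi, rfl⟩
  · intro i j hi hin hj hij
    rcases hj.lt_or_eq with hj | rfl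
    · exact hv hin hj hij
    · rw [hvn] at hij
      have := hv hin (show 0 ∈ Set.Iio j by simp; omega) hij
      omega
  · intro i hi hin hiX
    have : v i ∈ V(R.G) ∩ X := ⟨(hl i hin).left_mem, hiX⟩
    rw [hs, Set.mem_singleton_iff, ← h0] at this
    have := hv hin (show 0 ∈ Set.Iio n by simp; omega) this
    omega
  · intro J' hJ' b hbB hbv
    have hbs : b = s := by
      rw [hvn, h0, or_self] at hbv
      exact hbv
    subst hbs
    have hsT : b ∉ R.T := fun h => by
      have : b ∈ (V(R.G) ∩ X) ∩ R.B ∩ R.T := ⟨⟨hsm, hbB⟩, h⟩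
      rw [hbond] at this
      exact this
    have hnoJ : ∀ f ∈ J, ¬ R.G.IsNonloopAt f b := fun f hf hfn =>
      hsT ((hJ.mem_iff_of_subsingleton hsm.1 hthin).2 ⟨f, hf, hfn⟩)
    -- As `J` misses the bond, toggling an initial segment keeps `e (n - 1)` out, and toggling a
    -- final one keeps `e 0` out.
    rcases hJ' with rfl | ⟨i, hi0, hin, rfl | rfl⟩
    · exact hthin
    · have : e (n - 1) ∉ J ∆ (e '' Set.Ico 0 i) := by
        rintro (h | h)
        · exact hnoJ _ h.1 hnln
        · obtain ⟨j, hj, hje⟩ := h.1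
          have hj2 : j < i := hj.2
          have := he (show j ∈ Set.Iio n by simp; omega) (show n - 1 ∈ Set.Iio n by simp; omega) hje
          omega
      exact subsingleton_of_subset_pair_of_notMem (Set.pair_comm (e 0) _ ▸ hends) fun h => this h.1
    · have : e 0 ∉ J ∆ (e '' Set.Ico i n) := by
        rintro (h | h)
        · exact hJ0 h.1
        · obtain ⟨j, hj, hje⟩ := h.1
          have hj1 : i ≤ j := hj.1
          have hj2 : j < n := hj.2
          have := he (show j ∈ Set.Iio n by simp; omega) (show 0 ∈ Set.Iio n by simp; omega) hje
          omega
      exact subsingleton_of_subset_pair_of_notMem hends fun h => this h.1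

/-- The only bond is `s`, so the segment back to `s` must be toggled. This works because the join is
forced from the free end: it contains precisely the edges whose end farther from `s` is in `B`. -/
lemma exists_thin_of_straight {R : Quad α β} {X : Set α} {s t : α} (hb : R.IsBipartiteGraft)
    (hP : IsPathBetween R.G s t) (hne : E(R.G).Nonempty) (hs : V(R.G) ∩ X = {s})
    (hT : (V(R.G) \ X) ∩ R.B ⊆ R.T) (ht : t ∉ R.A ∩ R.T) (hint : V(R.G) \ {s, t} ⊆ R.T) :
    (∃ J, IsJoin R.G R.T J ∧ IsThin R.G R.B J) ∧
      ∀ x ∈ V(R.G) \ X, ∃ y ∈ V(R.G) ∩ X, ∃ J,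
        IsJoin R.G (R.T ∆ ({x} ∆ {y})) J ∧ IsThin R.G R.B J := by
  have hEf := hb.finite_edgeSet
  obtain ⟨n, v, e, h0, hvn, hvi, hl, hV, hE⟩ := hP
  have he := injOn_edges_of_path hvi hl
  have key : ∀ a b, a ≤ n → b ≤ n → v a = v b → a = b := fun a b ha hb => hvi ha hb
  have hn : 0 < n := by
    rw [hE] at hne
    obtain ⟨_, i, hi, -⟩ := hne
    exact lt_of_le_of_lt (Nat.zero_le i) hi
  have hsm : s ∈ V(R.G) ∩ X := hs ▸ Set.mem_singleton s
  have hVi : ∀ i ≤ n, v i ∈ V(R.G) := fun i hi => hV ▸ ⟨i, hi, rfl⟩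
  have hX : ∀ i, 0 < i → i ≤ n → v i ∉ X := by
    intro i hi hin hiX
    have : v i ∈ V(R.G) ∩ X := ⟨hVi i hin, hiX⟩
    rw [hs, Set.mem_singleton_iff, ← h0] at this
    have := key _ _ hin (by omega) this
    omega
  have hsub : ∀ {J' : Set β} {i : ℕ}, 0 < i → i < n →
      {f ∈ J' | R.G.IsNonloopAt f (v i)} ⊆ {e (i - 1), e i} := fun {J'} {i} hi hin f hf =>
    eq_or_eq_of_isNonloopAt_interior hl hE (fun i j _ hi hj => key i j hi.le hj) hi hin hf.2
  have hends : ∀ (J' : Set β) {b : α}, b = v 0 ∨ b = v n →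
      {f ∈ J' | R.G.IsNonloopAt f b}.Subsingleton := fun J' {b} =>
    subsingleton_at_path_ends hvi hl hE J'
  obtain ⟨J, hJ⟩ := hb.isGraft.exists_isJoin hb.finite_vertexSet hEf
  -- `k` counts edges from the free end. The conditions on `t` settle the last edge; interior
  -- vertices are all in `T'`, so membership in `J` then alternates.
  have alt : ∀ k j, j + k + 1 = n → (e j ∈ J ↔ v (j + 1) ∈ R.B) := by
    intro k
    induction k with
    | zero =>
      intro j hj
      have hj' : j + 1 = n := by omega
      have hlj := hl j (by omega)
      have hVj := hVi (j + 1) (by omega)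
      have hss := hends J (b := v (j + 1)) (Or.inr (by rw [hj']))
      have hnl := hb.isNonloopAt_of_isLink hlj.symm
      have hmem := hJ.mem_iff_of_subsingleton hVj hss
      constructor
      · intro hej
        have hvT := hmem.2 ⟨_, hej, hnl⟩
        refine (hb.mem_or_mem hVj).resolve_left fun hA => ht ?_
        rw [← hvn, ← hj']
        exact ⟨hA, hvT⟩
      · intro hB
        obtain ⟨f, hf, hfn⟩ := hmem.1 (hT ⟨⟨hVj, hX _ (by omega) (by omega)⟩, hB⟩)
        have hfE := hfn.edge_mem
        rw [hE] at hfE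
        obtain ⟨i, hi, rfl⟩ := hfE
        have hi' : i < n := hi
        rcases hfn.inc.eq_or_eq_of_isLink (hl i hi') with h | h
        · have := key _ _ (by omega) (by omega) h
          omega
        · have := key _ _ (by omega) (by omega) h
          obtain rfl : j = i := by omega
          exact hf
    | succ k ih =>
      intro j hj
      have hlj := hl j (by omega)
      have hlj' := hl (j + 1) (by omega)
      have hVj := hVi (j + 1) (by omega)
      have hmemT : v (j + 1) ∈ R.T := by
        refine hint ⟨hVj, ?_⟩
        rintro (h | h)
        · rw [← h0] at h
          have := key _ _ (by omega) (by omega) h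
          omega
        · rw [Set.mem_singleton_iff, ← hvn] at h
          have := key _ _ (by omega) (by omega) h
          omega
      have hss := subsingleton_of_subset_pair_of_odd
        (hsub (J' := J) (i := j + 1) (by omega) (by omega)) ((hJ.2 _ hVj).2 hmemT)
      have hnl := hb.isNonloopAt_of_isLink hlj.symm
      have hnl' := hb.isNonloopAt_of_isLink hlj'
      have hAB := hb.mem_left_iff_of_isLink hlj'
      have ihj := ih (j + 1) (by omega)
      by_cases hmem : e (j + 1) ∈ J
      · have hA := hAB.2 (ihj.1 hmem)
        have h1 : e j ∉ J := fun hc => by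
          have h2 : e j = e (j + 1) := hss ⟨hc, hnl⟩ ⟨hmem, hnl'⟩
          have := he (show j ∈ Set.Iio n by simp; omega) (show j + 1 ∈ Set.Iio n by simp; omega) h2
          omega
        exact ⟨fun h => absurd h h1, fun h => absurd h (hb.notMem_right hA)⟩
      · have hB : v (j + 1) ∈ R.B :=
          (hb.mem_or_mem hVj).resolve_left fun hA => hmem (ihj.2 (hAB.1 hA))
        refine ⟨fun _ => hB, fun _ => ?_⟩
        obtain ⟨f, hf, hfn⟩ := hJ.exists_of_mem hVj hmemT
        rcases hsub (J' := J) (i := j + 1) (by omega) (by omega) ⟨hf, hfn⟩ with h | h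
        · rw [Nat.add_sub_cancel] at h
          exact h ▸ hf
        · exact absurd (h ▸ hf) hmem
  constructor
  · refine ⟨J, hJ, fun b hbB => ?_⟩
    have hbV := hb.mem_vertexSet_right hbB
    have hbV' := hbV
    rw [hV] at hbV'
    obtain ⟨i, hi, rfl⟩ := hbV'
    have hi' : i ≤ n := hi
    rcases Nat.eq_zero_or_pos i with rfl | hi0
    · exact hends J (Or.inl rfl)
    rcases hi'.lt_or_eq with hin | rfl
    · exact subsingleton_of_subset_pair_of_odd (hsub hi0 hin)
        ((hJ.2 _ hbV).2 (hT ⟨⟨hbV, hX i hi0 hi'⟩, hbB⟩))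
    · exact hends J (Or.inr rfl)
  · rintro x ⟨hxV, hxX⟩
    rw [hV] at hxV
    obtain ⟨i, hi, rfl⟩ := hxV
    have hi' : i ≤ n := hi
    have hi0 : 0 < i := Nat.pos_of_ne_zero fun h => hxX (by rw [h, h0]; exact hsm.2)
    have hJ' := hJ.symmDiff hEf (isJoin_segment hEf he hl (Nat.zero_le i) hi')
    rw [symmDiff_comm ({v 0} : Set α)] at hJ'
    refine ⟨v 0, h0 ▸ hsm, _, hJ', fun b hbB => ?_⟩
    have hbV := hb.mem_vertexSet_right hbB
    have hbV' := hbV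
    rw [hV] at hbV'
    obtain ⟨j, hj, rfl⟩ := hbV'
    have hj' : j ≤ n := hj
    rcases Nat.eq_zero_or_pos j with rfl | hj0
    · exact hends _ (Or.inl rfl)
    rcases hj'.lt_or_eq with hjn | rfl
    · by_cases hji : j = i
      · subst hji
        have hmem : e (j - 1) ∈ J := by
          refine (alt (n - j) (j - 1) (by omega)).2 ?_
          rwa [show j - 1 + 1 = j by omega]
        refine subsingleton_of_subset_pair_of_notMem (hsub hj0 hjn) ?_
        rintro ⟨hc | hc, -⟩
        · exact hc.2 ⟨j - 1, ⟨Nat.zero_le _, by omega⟩, rfl⟩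
        · exact hc.2 hmem
      · refine subsingleton_of_subset_pair_of_odd (hsub hj0 hjn) ((hJ'.2 _ hbV).2 ?_)
        refine Or.inl ⟨hT ⟨⟨hbV, hX j hj0 hj'⟩, hbB⟩, ?_⟩
        rintro (hc | hc)
        · exact hji (key _ _ hj' hi' hc.1)
        · have := key _ _ hj' (by omega) hc.1
          omega
    · exact hends _ (Or.inr rfl)

lemma Quad.IsEffectiveEarGraft.exists_thin {Q R : Quad α β} (h : Q.IsEffectiveEarGraft R) :
    (∃ J, IsJoin R.G R.T J ∧ IsThin R.G R.B J) ∧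
      ∀ x ∈ V(R.G) \ V(Q.G), ∃ y ∈ V(R.G) ∩ V(Q.G), ∃ J,
        IsJoin R.G (R.T ∆ ({x} ∆ {y})) J ∧ IsThin R.G R.B J := by
  have hb := h.isBipartiteGraft
  rcases h.isEar with ⟨hne, ⟨s, t, hP, hst⟩ | ⟨hc, s, hs⟩⟩ | ⟨s, t, hst⟩
  · obtain ⟨n, v, e, h0, hvn, hv, hl, hV, hE⟩ := hP
    obtain ⟨J, hJ⟩ := hb.isGraft.exists_isJoin hb.finite_vertexSet hb.finite_edgeSet
    have hsm : s ∈ V(R.G) ∩ V(Q.G) := hst ▸ Set.mem_insert s _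
    have htm : t ∈ V(R.G) ∩ V(Q.G) := hst ▸ Set.mem_insert_of_mem s rfl
    refine exists_thin_of_round hb (injOn_edges_of_path hv hl) hl hE ?_ ?_ (h0 ▸ hsm.2)
      (hvn ▸ htm.2) ?_ h.nonbond hJ ?_
    · intro x hx
      rw [hV] at hx
      obtain ⟨i, hi, rfl⟩ := hx
      exact ⟨i, hi, rfl⟩
    · exact fun i j _ hi hj hij => hv hi.le hj hij
    · intro i hi hin hiX
      have : v i ∈ V(R.G) ∩ V(Q.G) := ⟨(hl i hin).left_mem, hiX⟩
      rw [hst] at this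
      rcases this with hc | hc
      · rw [← h0] at hc
        have := hv hin.le (show 0 ∈ Set.Iic n by simp) hc
        omega
      · rw [Set.mem_singleton_iff, ← hvn] at hc
        have := hv hin.le (show n ∈ Set.Iic n by simp) hc
        omega
    · exact fun J' _ b _ hbv => subsingleton_at_path_ends hv hl hE J' hbv
  · exact exists_thin_of_circuit hb hc hs h.nonbond h.bond
  · obtain ⟨h1, -, h3⟩ := h.straight s t hst
    exact exists_thin_of_straight hb hst.2.1 hst.1 hst.2.2 h.nonbond h1 h3

/-! ### Sums of grafts -/

lemma graphSum_isNonloopAt_left {G₁ G₂ : Graph α β} (h : G₁.Compatible G₂) {e : β}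
    (he : e ∈ E(G₁)) (v : α) : (graphSum G₁ G₂ h).IsNonloopAt e v ↔ G₁.IsNonloopAt e v := by
  constructor
  · rintro ⟨y, hy, hl | hl⟩
    · exact ⟨y, hy, hl⟩
    · exact ⟨y, hy, hl.of_compatible h.symm he⟩
  · rintro ⟨y, hy, hl⟩
    exact ⟨y, hy, Or.inl hl⟩

lemma graphSum_isNonloopAt_right {G₁ G₂ : Graph α β} (h : G₁.Compatible G₂) {e : β}
    (he : e ∈ E(G₂)) (v : α) : (graphSum G₁ G₂ h).IsNonloopAt e v ↔ G₂.IsNonloopAt e v := by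
  constructor
  · rintro ⟨y, hy, hl | hl⟩
    · exact ⟨y, hy, hl.of_compatible h he⟩
    · exact ⟨y, hy, hl⟩
  · rintro ⟨y, hy, hl⟩
    exact ⟨y, hy, Or.inr hl⟩

lemma IsJoin.of_le {G H : Graph α β} (hHG : H ≤ G) {T : Set α} {F : Set β} (hT : T ⊆ V(H))
    (h : IsJoin H T F) : IsJoin G T F := by
  refine ⟨h.1.trans hHG.edgeSet_mono, fun v _ => ?_⟩
  have hset : {e ∈ F | G.IsNonloopAt e v} = {e ∈ F | H.IsNonloopAt e v} := by
    ext e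
    simp only [Set.mem_ofPred_eq]
    exact and_congr_right fun he => (hHG.isNonloopAt_congr (h.1 he)).symm
  rw [hset]
  by_cases hv : v ∈ V(H)
  · exact h.2 v hv
  · have h0 : {e ∈ F | H.IsNonloopAt e v} = ∅ := by
      ext e
      simp only [Set.mem_ofPred_eq, Set.mem_empty_iff_false, iff_false]
      exact fun he => hv he.2.vertex_mem
    rw [h0]
    simpa using fun hvT => hv (hT hvT)

lemma le_graphSum_left {G₁ G₂ : Graph α β} (h : G₁.Compatible G₂) : G₁ ≤ graphSum G₁ G₂ h :=
  ⟨Set.subset_union_left, fun _ _ _ hl => Or.inl hl⟩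

lemma le_graphSum_right {G₁ G₂ : Graph α β} (h : G₁.Compatible G₂) : G₂ ≤ graphSum G₁ G₂ h :=
  ⟨Set.subset_union_right, fun _ _ _ hl => Or.inr hl⟩

lemma symmDiff_subset_of_subset {γ : Type*} {S T X : Set γ} (hS : S ⊆ X) (hT : T ⊆ X) :
    S ∆ T ⊆ X := by
  rintro x (hx | hx)
  · exact hS hx.1
  · exact hT hx.1

lemma pair_symmDiff_subset {x y : α} {X : Set α} (hx : x ∈ X) (hy : y ∈ X) :
    ({x} ∆ {y} : Set α) ⊆ X :=
  symmDiff_subset_of_subset (Set.singleton_subset_iff.2 hx) (Set.singleton_subset_iff.2 hy)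

/-- A thin join meets a vertex of `B` exactly when that vertex is in its `T`. So at a shared vertex
of `B` not in both `T₁` and `T₂`, one join has no edge. The symmetric difference allows for common
edges of the two graphs. -/
lemma IsThin.graphSum {G₁ G₂ : Graph α β} (h : G₁.Compatible G₂) {B₁ B₂ T₁ T₂ : Set α}
    {F₁ F₂ : Set β} (hF₁ : IsJoin G₁ T₁ F₁) (hF₂ : IsJoin G₂ T₂ F₂)
    (ht₁ : IsThin G₁ B₁ F₁) (ht₂ : IsThin G₂ B₂ F₂)
    (h₁ : ∀ b ∈ B₁, b ∈ V(G₁) ∧ (b ∈ V(G₂) → b ∈ B₂ ∧ ¬ (b ∈ T₁ ∧ b ∈ T₂)))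
    (h₂ : ∀ b ∈ B₂, b ∈ V(G₂) ∧ (b ∈ V(G₁) → b ∈ B₁)) :
    IsThin (graphSum G₁ G₂ h) (B₁ ∪ B₂) (F₁ ∆ F₂) := by
  intro b hb
  have hsub : {e ∈ F₁ ∆ F₂ | (BipGraft.graphSum G₁ G₂ h).IsNonloopAt e b} ⊆
      {e ∈ F₁ | G₁.IsNonloopAt e b} ∪ {e ∈ F₂ | G₂.IsNonloopAt e b} := by
    rintro e ⟨he | he, hn⟩
    · exact Or.inl ⟨he.1, (graphSum_isNonloopAt_left h (hF₁.1 he.1) b).1 hn⟩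
    · exact Or.inr ⟨he.1, (graphSum_isNonloopAt_right h (hF₂.1 he.1) b).1 hn⟩
  have hleft : b ∈ B₁ → (¬ ∃ e ∈ F₂, G₂.IsNonloopAt e b) →
      {e ∈ F₁ ∆ F₂ | (BipGraft.graphSum G₁ G₂ h).IsNonloopAt e b}.Subsingleton := by
    intro hb1 hno
    refine (ht₁ b hb1).anti fun e he => (hsub he).resolve_right fun hc => hno ⟨e, hc⟩
  have hright : b ∈ B₂ → (¬ ∃ e ∈ F₁, G₁.IsNonloopAt e b) →
      {e ∈ F₁ ∆ F₂ | (BipGraft.graphSum G₁ G₂ h).IsNonloopAt e b}.Subsingleton := by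
    intro hb2 hno
    refine (ht₂ b hb2).anti fun e he => (hsub he).resolve_left fun hc => hno ⟨e, hc⟩
  by_cases hb1 : b ∈ B₁
  · obtain ⟨hV1, hcond⟩ := h₁ b hb1
    by_cases hV2 : b ∈ V(G₂)
    · obtain ⟨hb2, hnot⟩ := hcond hV2
      by_cases hT2 : b ∈ T₂
      · refine hright hb2 fun hex => hnot ⟨?_, hT2⟩
        exact (hF₁.mem_iff_of_subsingleton hV1 (ht₁ b hb1)).2 hex
      · exact hleft hb1 fun hex =>
          hT2 ((hF₂.mem_iff_of_subsingleton hV2 (ht₂ b hb2)).2 hex)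
    · exact hleft hb1 fun ⟨e, _, hn⟩ => hV2 hn.vertex_mem
  · have hb2 := hb.resolve_left hb1
    exact hright hb2 fun ⟨e, _, hn⟩ => hb1 ((h₂ b hb2).2 hn.vertex_mem)

theorem Quad.HasThinJoins.sum {Q R : Quad α β} {r : α} (hQ : Q.HasThinJoins r)
    (hR : Q.IsEffectiveEarGraft R) : (Q.sum R hR.compatible).HasThinJoins r := by
  have hq := hQ.isBipartiteGraft
  have hr := hR.isBipartiteGraft
  have hrV := hq.mem_vertexSet_right hQ.root_mem
  have hBR : ∀ b ∈ Q.B, b ∈ V(R.G) → b ∈ R.B := fun b hb hbV =>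
    (hr.mem_or_mem hbV).resolve_left fun hA => Set.disjoint_left.1 hR.disjoint_right hA hb
  have hBQ : ∀ b ∈ R.B, b ∈ V(Q.G) → b ∈ Q.B := fun b hb hbV =>
    (hq.mem_or_mem hbV).resolve_left fun hA => Set.disjoint_left.1 hR.disjoint_left hA hb
  have hbond : ∀ b ∈ Q.B, b ∈ V(R.G) → b ∉ R.T := fun b hb hbV hbT => by
    have : b ∈ (V(R.G) ∩ V(Q.G)) ∩ R.B ∩ R.T :=
      ⟨⟨⟨hbV, hq.mem_vertexSet_right hb⟩, hBR b hb hbV⟩, hbT⟩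
    rw [hR.bond] at this
    exact this
  have hbond' : ∀ b ∈ Q.B, b ∉ R.T := fun b hb hbT => hbond b hb (hr.isGraft.1 hbT) hbT
  have hVf : V((Q.sum R hR.compatible).G).Finite := hq.finite_vertexSet.union hr.finite_vertexSet
  have hEf : E((Q.sum R hR.compatible).G).Finite := hq.finite_edgeSet.union hr.finite_edgeSet
  have combine : ∀ {T₁ T₂ F₁ F₂}, T₁ ⊆ V(Q.G) → T₂ ⊆ V(R.G) → IsJoin Q.G T₁ F₁ →
      IsJoin R.G T₂ F₂ → IsThin Q.G Q.B F₁ → IsThin R.G R.B F₂ →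
      (∀ b ∈ Q.B, b ∈ V(R.G) → ¬ (b ∈ T₁ ∧ b ∈ T₂)) →
      IsJoin (Q.sum R hR.compatible).G (T₁ ∆ T₂) (F₁ ∆ F₂) ∧
      IsThin (Q.sum R hR.compatible).G (Q.sum R hR.compatible).B (F₁ ∆ F₂) := by
    intro T₁ T₂ F₁ F₂ hT₁ hT₂ hF₁ hF₂ ht₁ ht₂ hno
    refine ⟨(hF₁.of_le (le_graphSum_left hR.compatible) hT₁).symmDiff hEf
      (hF₂.of_le (le_graphSum_right hR.compatible) hT₂), ?_⟩
    exact IsThin.graphSum hR.compatible hF₁ hF₂ ht₁ ht₂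
      (fun b hb => ⟨hq.mem_vertexSet_right hb, fun hbV => ⟨hBR b hb hbV, hno b hb hbV⟩⟩)
      (fun b hb => ⟨hr.mem_vertexSet_right hb, hBQ b hb⟩)
  obtain ⟨⟨J, hJ, hJt⟩, hear⟩ := hR.exists_thin
  have exQ : ∀ x ∈ V(Q.G), ∃ F, IsJoin (Q.sum R hR.compatible).G
      ((Q.T ∆ R.T) ∆ ({x} ∆ {r})) F ∧
      IsThin (Q.sum R hR.compatible).G (Q.sum R hR.compatible).B F := by
    intro x hx
    obtain ⟨F, hF, hFt⟩ := hQ.exists_thin x hx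
    have := combine (symmDiff_subset_of_subset hq.isGraft.1 (pair_symmDiff_subset hx hrV))
      hr.isGraft.1 hF hJ hFt hJt (fun b hb _ h => hbond' b hb h.2)
    rw [symmDiff_right_comm] at this
    exact ⟨_, this⟩
  -- For a new `x`, the ear join for `{x, y}` and the old join for `{y, r}` meet at the bond `y`,
  -- whose contributions cancel.
  have exR : ∀ x ∈ V(R.G) \ V(Q.G), ∃ F, IsJoin (Q.sum R hR.compatible).G
      ((Q.T ∆ R.T) ∆ ({x} ∆ {r})) F ∧
      IsThin (Q.sum R hR.compatible).G (Q.sum R hR.compatible).B F := by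
    intro x hx
    obtain ⟨y, hy, J', hJ', hJt'⟩ := hear x hx
    obtain ⟨F, hF, hFt⟩ := hQ.exists_thin y hy.2
    have := combine (symmDiff_subset_of_subset hq.isGraft.1 (pair_symmDiff_subset hy.2 hrV))
      (symmDiff_subset_of_subset hr.isGraft.1 (pair_symmDiff_subset hx.1 hy.1)) hF hJ' hFt hJt' ?_
    · refine ⟨_, ?_, this.2⟩
      have hs : (Q.T ∆ ({y} ∆ {r})) ∆ (R.T ∆ ({x} ∆ {y})) = (Q.T ∆ R.T) ∆ ({x} ∆ {r}) := by
        rw [symmDiff_symmDiff_symmDiff_comm, symmDiff_comm ({y} ∆ {r} : Set α) ({x} ∆ {y}),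
          symmDiff_assoc ({x} : Set α), symmDiff_symmDiff_cancel_left]
      rw [← hs]
      exact this.1
    -- For `b ∈ Q.B`, the first membership means `b ≠ y`. The second means `b = y`, since such `b`
    -- is neither in `R.T` nor equal to `x`.
    · rintro b hb - ⟨hb1, hb2⟩
      have hbx : b ≠ x := fun h => hx.2 (h ▸ hq.mem_vertexSet_right hb)
      have h1 := hbond' b hb
      have h2 := hQ.mem_T_iff b hb
      simp only [Set.mem_symmDiff, Set.mem_singleton_iff] at hb1 hb2
      grind
  refine ⟨⟨hVf, hEf, ?_, ?_, ?_, ?_⟩, Or.inl hQ.root_mem, ?_, ?_⟩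
  · obtain ⟨F, hF, -⟩ := exQ r hrV
    rw [symmDiff_pair_self] at hF
    exact hF.isGraft hVf hEf (symmDiff_subset_of_subset
      (hq.isGraft.1.trans Set.subset_union_left) (hr.isGraft.1.trans Set.subset_union_right))
  · refine Set.disjoint_left.2 ?_
    rintro x (hx | hx) (hx' | hx')
    · exact hq.notMem_right hx hx'
    · exact Set.disjoint_left.1 hR.disjoint_left hx hx'
    · exact Set.disjoint_left.1 hR.disjoint_right hx hx'
    · exact hr.notMem_right hx hx'
  · change (Q.A ∪ R.A) ∪ (Q.B ∪ R.B) = V(Q.G) ∪ V(R.G)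
    rw [Set.union_union_union_comm, hq.union_eq, hr.union_eq]
  · rintro e (he | he)
    · obtain ⟨a, ha, b, hb, hl⟩ := hq.bipartite e he
      exact ⟨a, Or.inl ha, b, Or.inl hb, Or.inl hl⟩
    · obtain ⟨a, ha, b, hb, hl⟩ := hr.bipartite e he
      exact ⟨a, Or.inr ha, b, Or.inr hb, Or.inr hl⟩
  · intro b hb
    change b ∈ Q.T ∆ R.T ↔ _
    by_cases hbQ : b ∈ Q.B
    · have h1 := hbond' b hbQ
      rw [← hQ.mem_T_iff b hbQ, Set.mem_symmDiff]
      tauto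
    · have hbR := hb.resolve_left hbQ
      have hbV : b ∉ V(Q.G) := fun h => hbQ (hBQ b hbR h)
      have hbT : b ∈ R.T := hR.nonbond ⟨⟨hr.mem_vertexSet_right hbR, hbV⟩, hbR⟩
      have hbr : b ≠ r := fun h => hbQ (h ▸ hQ.root_mem)
      have hbT' : b ∉ Q.T := fun h => hbV (hq.isGraft.1 h)
      rw [Set.mem_symmDiff]
      tauto
  · intro x hx
    by_cases hxQ : x ∈ V(Q.G)
    · exact exQ x hxQ
    · exact exR x ⟨hx.resolve_left hxQ, hxQ⟩

lemma hasThinJoins_single (r : α) : (Quad.single β r).HasThinJoins r := by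
  refine ⟨⟨Set.finite_singleton r, Set.finite_empty, ?_, Set.empty_disjoint _,
    Set.empty_union _, ?_⟩, rfl, ?_, ?_⟩
  · exact ⟨Set.empty_subset _, fun _ _ => by simp [Quad.single]⟩
  · rintro e ⟨⟩
  · rintro b rfl
    simp [Quad.single]
  · rintro x rfl
    refine ⟨∅, ?_, fun b _ => by simp⟩
    rw [symmDiff_pair_self]
    exact isJoin_empty _

theorem CriticalFamily.hasThinJoins {Q : Quad α β} {r : α} (h : CriticalFamily r Q) :
    Q.HasThinJoins r := by
  induction h with
  | single => exact hasThinJoins_single r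
  | add Q R _ hR ih => exact ih.sum hR

/-! ### Growing an ear decomposition -/

/-- The vertices of `G` with an odd number of incident edges in `F`. -/
def oddSet (G : Graph α β) (F : Set β) : Set α :=
  {v ∈ V(G) | Odd {e ∈ F | G.IsNonloopAt e v}.ncard}

lemma isJoin_oddSet {G : Graph α β} {F : Set β} (hF : F ⊆ E(G)) : IsJoin G (oddSet G F) F :=
  ⟨hF, fun _ hv => ⟨fun h => ⟨hv, h⟩, fun h => h.2⟩⟩

lemma oddSet_subset (G : Graph α β) (F : Set β) : oddSet G F ⊆ V(G) := fun _ h => h.1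

/-- The part of `Q` on the subgraph `P`, where `T` is replaced by the set of vertices that are
odd with respect to the edges of `F` in `P`. -/
def Quad.part (Q : Quad α β) (F : Set β) (P : Graph α β) : Quad α β where
  G := P
  T := oddSet P (F ∩ E(P))
  A := Q.A ∩ V(P)
  B := Q.B ∩ V(P)

lemma Quad.part_self {Q : Quad α β} {F : Set β} (hb : Q.IsBipartiteGraft) (hF : IsJoin Q.G Q.T F) :
    Q.part F Q.G = Q := by
  have hA : Q.A ∩ V(Q.G) = Q.A := Set.inter_eq_left.2 fun _ => hb.mem_vertexSet_left
  have hB : Q.B ∩ V(Q.G) = Q.B := Set.inter_eq_left.2 fun _ => hb.mem_vertexSet_right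
  have hT : oddSet Q.G (F ∩ E(Q.G)) = Q.T := by
    rw [Set.inter_eq_left.2 hF.1]
    exact (isJoin_oddSet hF.1).eq_of_subset hF (oddSet_subset _ _) hb.isGraft.1
  simp only [Quad.part, hA, hB, hT]

/-- Edge-disjointness makes the two portions of `F` add up to their union, and the odd sets add
accordingly. -/
lemma Quad.part_sum {Q : Quad α β} {F : Set β} {H P : Graph α β} (h : H.Compatible P)
    (hHf : E(H).Finite) (hPf : E(P).Finite) (hd : Disjoint E(H) E(P)) :
    (Q.part F H).sum (Q.part F P) h = Q.part F (graphSum H P h) := by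
  have hT : oddSet H (F ∩ E(H)) ∆ oddSet P (F ∩ E(P)) =
      oddSet (graphSum H P h) (F ∩ E(graphSum H P h)) := by
    have h1 := ((isJoin_oddSet (Set.inter_subset_right (s := F))).of_le (le_graphSum_left h)
      (oddSet_subset _ _)).symmDiff (hHf.union hPf)
      ((isJoin_oddSet (Set.inter_subset_right (s := F))).of_le (le_graphSum_right h)
      (oddSet_subset _ _))
    have hs : (F ∩ E(H)) ∆ (F ∩ E(P)) = F ∩ E(graphSum H P h) := by
      ext e
      have : e ∈ E(H) → e ∉ E(P) := fun h => Set.disjoint_left.1 hd h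
      change _ ↔ e ∈ F ∧ (e ∈ E(H) ∨ e ∈ E(P))
      simp only [Set.mem_symmDiff, Set.mem_inter_iff]
      tauto
    rw [hs] at h1
    exact h1.eq_of_subset (isJoin_oddSet Set.inter_subset_right)
      (symmDiff_subset_of_subset ((oddSet_subset _ _).trans Set.subset_union_left)
        ((oddSet_subset _ _).trans Set.subset_union_right)) (oddSet_subset _ _)
  simp only [Quad.part, Quad.sum, hT, ← Set.inter_union_distrib_left]
  rfl

/-- The subgraph `H` of `Q.G` carries a member of the critical family, with respect to a fixed
join `F`, and is closed under the edges of `F` at the vertices of `B`. -/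
structure Quad.IsGrown (Q : Quad α β) (r : α) (F : Set β) (H : Graph α β) : Prop where
  le : H ≤ Q.G
  root_mem : r ∈ V(H)
  family : CriticalFamily r (Q.part F H)
  closed : ∀ b ∈ Q.B, b ∈ V(H) → ∀ e ∈ F, Q.G.IsNonloopAt e b → e ∈ E(H)

lemma Quad.HasThinJoins.isGrown_noEdge {Q : Quad α β} {r : α} {F : Set β} (h : Q.HasThinJoins r)
    (hF : IsJoin Q.G Q.T F) (ht : IsThin Q.G Q.B F) :
    Q.IsGrown r F (Graph.noEdge {r} β) := by
  have hb := h.isBipartiteGraft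
  have hrV := hb.mem_vertexSet_right h.root_mem
  refine ⟨noEdge_le_iff.2 (Set.singleton_subset_iff.2 hrV), rfl, ?_, ?_⟩
  · have : Q.part F (Graph.noEdge {r} β) = Quad.single β r := by
      have hA : Q.A ∩ {r} = ∅ := by
        rw [Set.inter_singleton_eq_empty]
        exact fun hA => hb.notMem_right hA h.root_mem
      have hB : Q.B ∩ {r} = {r} := Set.inter_eq_right.2 (Set.singleton_subset_iff.2 h.root_mem)
      have hT : oddSet (Graph.noEdge {r} β) (F ∩ E(Graph.noEdge {r} β)) = ∅ := by
        refine (isJoin_oddSet Set.inter_subset_right).eq_of_subset ?_ (oddSet_subset _ _)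
          (Set.empty_subset _)
        have : F ∩ E(Graph.noEdge {r} β) = ∅ := Set.inter_empty F
        rw [this]
        exact isJoin_empty _
      simp only [Quad.part, Quad.single, hT]
      change Quad.mk _ _ (Q.A ∩ {r}) (Q.B ∩ {r}) = _
      rw [hA, hB]
    rw [this]
    exact CriticalFamily.single
  · rintro b hbB rfl e he hn
    have := (hF.mem_iff_of_subsingleton hrV (ht _ hbB)).2 ⟨e, he, hn⟩
    exact absurd rfl ((h.mem_T_iff _ hbB).1 this)

/-- Effectiveness comes from closure: the `F`-edge at a bond in `B`, if any, is already in `H`, so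
the bond is not in `T'`; `hnb` puts the other vertices of `B` into `T'`. By thinness the `F`-edge
given by `hnb` is the only one, so the sum is closed again. -/
lemma Quad.IsGrown.addEar {Q : Quad α β} {r : α} {F : Set β} {H P : Graph α β}
    (hQ : Q.HasThinJoins r) (ht : IsThin Q.G Q.B F) (hH : Q.IsGrown r F H)
    (hP : P ≤ Q.G) (hd : Disjoint E(H) E(P))
    (hnb : ∀ b ∈ Q.B, b ∈ V(P) → b ∉ V(H) → ∃ e ∈ F, P.IsNonloopAt e b)
    (hear : IsRoundEar P V(H) ∨ ∃ s v, IsStraightEar P V(H) s v)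
    (hst : ∀ s v, IsStraightEar P V(H) s v →
      v ∉ (Q.part F P).A ∩ (Q.part F P).T ∧ s ∉ (Q.part F P).A \ (Q.part F P).T ∧
        V(P) \ {s, v} ⊆ (Q.part F P).T) :
    ∃ H', Q.IsGrown r F H' ∧ E(H) ⊂ E(H') := by
  have hb := hQ.isBipartiteGraft
  have hc : H.Compatible P := Compatible.of_le_le hH.le hP
  have hPf := hb.finite_edgeSet.subset hP.edgeSet_mono
  have hPV := hb.finite_vertexSet.subset hP.vertexSet_mono
  have hne : E(P).Nonempty := by
    rcases hear with h | ⟨s, v, h⟩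
    · exact h.1
    · exact h.1
  have hthinP : ∀ b ∈ Q.B, {e ∈ F ∩ E(P) | P.IsNonloopAt e b}.Subsingleton := fun b hbB =>
    (ht b hbB).anti fun e he => ⟨he.1.1, he.2.mono hP⟩
  have hmem : ∀ b ∈ Q.B, b ∈ V(P) → (b ∈ (Q.part F P).T ↔ ∃ e ∈ F ∩ E(P), P.IsNonloopAt e b) :=
    fun b hbB hbP => (isJoin_oddSet Set.inter_subset_right).mem_iff_of_subsingleton hbP
      (hthinP b hbB)
  have hR : (Q.part F H).IsEffectiveEarGraft (Q.part F P) := by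
    refine ⟨⟨hPV, hPf, ?_, ?_, ?_, ?_⟩, hc, ?_, ?_, hear, ?_, ?_, hst⟩
    · exact (isJoin_oddSet Set.inter_subset_right).isGraft hPV hPf (oddSet_subset _ _)
    · exact hb.disjoint.mono Set.inter_subset_left Set.inter_subset_left
    · change Q.A ∩ V(P) ∪ Q.B ∩ V(P) = V(P)
      rw [← Set.union_inter_distrib_right, hb.union_eq]
      exact Set.inter_eq_right.2 hP.vertexSet_mono
    · intro e he
      obtain ⟨a, ha, b, hbB, hl⟩ := hb.bipartite e (hP.edgeSet_mono he)
      have hl' : P.IsLink e a b := (hP.isLink_iff he).2 hl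
      exact ⟨a, ⟨ha, hl'.left_mem⟩, b, ⟨hbB, hl'.right_mem⟩, hl'⟩
    · exact hb.disjoint.mono Set.inter_subset_left Set.inter_subset_left
    · exact hb.disjoint.mono Set.inter_subset_left Set.inter_subset_left
    · rintro b ⟨⟨hbP, hbH⟩, hbB⟩
      obtain ⟨e, he, hn⟩ := hnb b hbB.1 hbP hbH
      exact (hmem b hbB.1 hbP).2 ⟨e, ⟨he, hn.edge_mem⟩, hn⟩
    · rw [Set.eq_empty_iff_forall_notMem]
      rintro b ⟨⟨⟨hbP, hbH⟩, hbB⟩, hbT⟩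
      obtain ⟨e, he, hn⟩ := (hmem b hbB.1 hbP).1 hbT
      exact Set.disjoint_left.1 hd (hH.closed b hbB.1 hbH e he.1 (hn.mono hP)) he.2
  refine ⟨graphSum H P hc, ⟨⟨Set.union_subset hH.le.vertexSet_mono hP.vertexSet_mono, ?_⟩,
    Or.inl hH.root_mem, ?_, ?_⟩, ?_⟩
  · rintro e x y (hl | hl)
    · exact hl.mono hH.le
    · exact hl.mono hP
  · rw [← Quad.part_sum hc (hb.finite_edgeSet.subset hH.le.edgeSet_mono) hPf hd]
    exact CriticalFamily.add _ _ hH.family hR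
  · intro b hbB hbV e he hn
    by_cases hbH : b ∈ V(H)
    · exact Or.inl (hH.closed b hbB hbH e he hn)
    · obtain ⟨f, hf, hfn⟩ := hnb b hbB (hbV.resolve_left hbH) hbH
      rw [ht b hbB ⟨he, hn⟩ ⟨hf, hfn.mono hP⟩]
      exact Or.inr hfn.edge_mem
  · refine ⟨Set.subset_union_left, fun hs => ?_⟩
    obtain ⟨e, he⟩ := hne
    exact Set.disjoint_left.1 hd (hs (Or.inr he)) he

/-! ### The ears that enlarge a grown subgraph -/

lemma IsPathBetween.ends {P : Graph α β} {s t : α} (h : IsPathBetween P s t)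
    (hne : E(P).Nonempty) : s ∈ V(P) ∧ t ∈ V(P) ∧ s ≠ t := by
  obtain ⟨n, v, e, rfl, rfl, hv, hl, hV, hE⟩ := h
  have hn : 0 < n := by
    rw [hE] at hne
    obtain ⟨_, i, hi, -⟩ := hne
    exact lt_of_le_of_lt (Nat.zero_le i) hi
  refine ⟨hV ▸ ⟨0, by simp, rfl⟩, hV ▸ ⟨n, by simp, rfl⟩, fun h => ?_⟩
  have := hv (show 0 ∈ Set.Iic n by simp) (show n ∈ Set.Iic n by simp) h
  omega

/-- A circuit has as many edges as vertices, a path fewer. -/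
lemma IsCircuit.not_isPathBetween {P : Graph α β} (h : IsCircuit P) (s t : α) :
    ¬ IsPathBetween P s t := by
  rintro ⟨m, w, f, -, -, hw, -, hV', hE'⟩
  obtain ⟨n, v, e, -, -, hv, he, -, hV, hE⟩ := h
  have h1 : V(P).ncard = n := by
    rw [hV, hv.ncard_image]
    simp [Set.ncard_eq_toFinset_card']
  have h2 : V(P).ncard = m + 1 := by
    rw [hV', hw.ncard_image]
    simp [Set.ncard_eq_toFinset_card']
  have h3 : E(P).ncard = n := by
    rw [hE, he.ncard_image]
    simp [Set.ncard_eq_toFinset_card']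
  have h4 : E(P).ncard ≤ m := by
    rw [hE']
    refine (Set.ncard_image_le (Set.finite_Iio m)).trans ?_
    simp [Set.ncard_eq_toFinset_card']
  omega

/-- If the new end is in `A`, then `x ∈ B` and closure of `H` forces `e ∉ F`; if it is in `B`, then
`e ∈ F` by `hy`. These are exactly the conditions on a straight ear with one edge. -/
lemma Quad.IsGrown.addEdge {Q : Quad α β} {r : α} {F : Set β} {H : Graph α β} {e : β} {x y : α}
    (hQ : Q.HasThinJoins r) (ht : IsThin Q.G Q.B F)
    (hH : Q.IsGrown r F H) (hl : Q.G.IsLink e x y) (hx : x ∈ V(H)) (he : e ∉ E(H))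
    (hy : y ∉ V(H) → y ∈ Q.B → e ∈ F) : ∃ H', Q.IsGrown r F H' ∧ E(H) ⊂ E(H') := by
  have hb := hQ.isBipartiteGraft
  have hxy := hb.ne_of_isLink hl
  have hl' : (banana x y {e}).IsLink e x y := by simp [banana]
  have hE : E(banana x y {e}) = {e} := rfl
  have hV : V(banana x y {e}) = {x, y} := rfl
  have hP : banana x y {e} ≤ Q.G := by
    refine ⟨?_, ?_⟩
    · rintro z (rfl | rfl)
      · exact hl.left_mem
      · exact hl.right_mem
    · intro f a b hf
      obtain rfl : f = e := hf.edge_mem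
      rcases hf.eq_and_eq_or_eq_and_eq hl' with ⟨rfl, rfl⟩ | ⟨rfl, rfl⟩
      · exact hl
      · exact hl.symm
  have hnx : (banana x y {e}).IsNonloopAt e x := ⟨y, hxy.symm, hl'⟩
  have hny : (banana x y {e}).IsNonloopAt e y := ⟨x, hxy, hl'.symm⟩
  have hpath : IsPathBetween (banana x y {e}) x y := by
    refine ⟨1, fun i => if i = 0 then x else y, fun _ => e, by simp, by simp, ?_, ?_, ?_, ?_⟩
    · intro i hi j hj hij
      simp only [Set.mem_Iic] at hi hj
      grind
    · intro i hi
      obtain rfl : i = 0 := by omega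
      exact hl'
    · rw [hV]
      ext z
      simp only [Set.mem_insert_iff, Set.mem_singleton_iff, Set.mem_image, Set.mem_Iic]
      constructor
      · rintro (rfl | rfl)
        · exact ⟨0, by simp⟩
        · exact ⟨1, by simp⟩
      · rintro ⟨i, -, rfl⟩
        split <;> simp
    · rw [hE]
      ext z
      simp only [Set.mem_singleton_iff, Set.mem_image, Set.mem_Iio]
      exact ⟨fun h => ⟨0, by simp, h.symm⟩, fun ⟨_, _, h⟩ => h.symm⟩
  have hmem : ∀ z, (banana x y {e}).IsNonloopAt e z →
      (z ∈ (Q.part F (banana x y {e})).T ↔ e ∈ F) := by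
    intro z hz
    have hss : {f ∈ F ∩ E(banana x y {e}) | (banana x y {e}).IsNonloopAt f z}.Subsingleton :=
      Set.subsingleton_singleton.anti fun f hf => hf.1.2
    refine ((isJoin_oddSet Set.inter_subset_right).mem_iff_of_subsingleton hz.vertex_mem hss).trans
      ⟨?_, fun h => ⟨e, ⟨h, rfl⟩, hz⟩⟩
    rintro ⟨f, ⟨hf, rfl⟩, -⟩
    exact hf
  refine hH.addEar hQ ht hP (by rw [hE]; exact Set.disjoint_singleton_right.2 he) ?_ ?_ ?_
  · rintro b hbB (rfl | rfl) hbH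
    · exact absurd hx hbH
    · exact ⟨e, hy hbH hbB, hny⟩
  · by_cases hyH : y ∈ V(H)
    · refine Or.inl ⟨⟨e, rfl⟩, Or.inl ⟨x, y, hpath, Set.inter_eq_left.2 ?_⟩⟩
      rintro z (rfl | rfl) <;> assumption
    · refine Or.inr ⟨x, y, ⟨e, rfl⟩, hpath, ?_⟩
      ext z
      simp only [hV, Set.mem_inter_iff, Set.mem_insert_iff, Set.mem_singleton_iff]
      grind
  · rintro s t ⟨hne, hst, hs⟩
    obtain ⟨hs1, ht1, hne'⟩ := hst.ends hne
    have hxs : x = s := by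
      have : x ∈ V(banana x y {e}) ∩ V(H) := ⟨Or.inl rfl, hx⟩
      rw [hs] at this
      exact this
    subst hxs
    have hty : t = y := ht1.resolve_left (Ne.symm hne')
    subst hty
    have htH : t ∉ V(H) := fun hc => by
      have : t ∈ V(banana x t {e}) ∩ V(H) := ⟨Or.inr rfl, hc⟩
      rw [hs] at this
      exact hxy this.symm
    refine ⟨?_, ?_, ?_⟩
    · rintro ⟨htA, htT⟩
      have heF := (hmem t hny).1 htT
      have hxB : x ∈ Q.B := (hb.mem_left_iff_of_isLink hl.symm).1 htA.1
      exact he (hH.closed x hxB hx e heF (hnx.mono hP))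
    · rintro ⟨hxA, hxT⟩
      exact hxT ((hmem x hnx).2 (hy htH ((hb.mem_left_iff_of_isLink hl).1 hxA.1)))
    · rw [hV, Set.sdiff_self]
      exact Set.empty_subset _

lemma Quad.IsGrown.addRound {Q : Quad α β} {r : α} {F : Set β} {H : Graph α β} {n : ℕ}
    {v : ℕ → α} {e : ℕ → β} (hQ : Q.HasThinJoins r)
    (ht : IsThin Q.G Q.B F) (hH : Q.IsGrown r F H) (hn : 2 ≤ n)
    (hl : ∀ i < n, Q.G.IsLink (e i) (v i) (v (i + 1)))
    (hv : Set.InjOn v (Set.Iio n)) (he : Set.InjOn e (Set.Iio n))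
    (h0 : v 0 ∈ V(H)) (hvn : v n ∈ V(H)) (hint : ∀ i, 0 < i → i < n → v i ∉ V(H))
    (hF : ∀ i, 0 < i → i < n → v i ∈ Q.B → e (i - 1) ∈ F ∨ e i ∈ F) :
    ∃ H', Q.IsGrown r F H' ∧ E(H) ⊂ E(H') := by
  have hb := hQ.isBipartiteGraft
  obtain ⟨P, hV, hE, hP, hPl⟩ : ∃ P : Graph α β, V(P) = v '' Set.Iic n ∧ E(P) = e '' Set.Iio n ∧
      P ≤ Q.G ∧ ∀ i < n, P.IsLink (e i) (v i) (v (i + 1)) := by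
    -- Restricting to the listed edges before inducing excludes chords and parallel edges.
    have hlink : ∀ i < n, ((Q.G.restrict (e '' Set.Iio n)).induce (v '' Set.Iic n)).IsLink
        (e i) (v i) (v (i + 1)) := by
      intro i hi
      simp only [induce_isLink, restrict_isLink]
      exact ⟨⟨⟨i, hi, rfl⟩, hl i hi⟩, ⟨i, hi.le, rfl⟩, ⟨i + 1, hi, rfl⟩⟩
    refine ⟨(Q.G.restrict (e '' Set.Iio n)).induce (v '' Set.Iic n), rfl, ?_, ?_, hlink⟩
    · ext f
      constructor
      · intro hf
        obtain ⟨x, y, hxy⟩ := exists_isLink_of_mem_edgeSet hf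
        simp only [induce_isLink, restrict_isLink] at hxy
        exact hxy.1.1
      · rintro ⟨i, hi, rfl⟩
        exact (hlink i hi).edge_mem
    · refine (induce_le ?_).trans restrict_le
      rintro _ ⟨i, hi, rfl⟩
      have hi' : i ≤ n := hi
      rcases hi'.lt_or_eq with h | rfl
      · exact (hl i h).left_mem
      · obtain ⟨k, rfl⟩ : ∃ k, i = k + 1 := ⟨i - 1, by omega⟩
        exact (hl k (by omega)).right_mem
  have hEne : E(P).Nonempty := ⟨e 0, (hPl 0 (by omega)).edge_mem⟩
  have hVH : V(P) ∩ V(H) = {v 0, v n} := by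
    rw [hV]
    ext x
    constructor
    · rintro ⟨⟨i, hi, rfl⟩, hiH⟩
      have hi' : i ≤ n := hi
      rcases Nat.eq_zero_or_pos i with rfl | hi0
      · exact Or.inl rfl
      · rcases hi'.lt_or_eq with h | rfl
        · exact absurd hiH (hint i hi0 h)
        · exact Or.inr rfl
    · rintro (rfl | rfl)
      · exact ⟨⟨0, by simp, rfl⟩, h0⟩
      · exact ⟨⟨n, by simp, rfl⟩, hvn⟩
  have hd : Disjoint E(H) E(P) := by
    refine Set.disjoint_left.2 fun f hfH hfP => ?_
    rw [hE] at hfP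
    obtain ⟨i, hi, rfl⟩ := hfP
    have hi' : i < n := hi
    have hlH := (hH.le.isLink_iff hfH).2 (hl i hi')
    -- Since `n ≥ 2`, every edge of the ear has an interior end, which lies outside `H`.
    rcases Nat.eq_zero_or_pos i with rfl | hi0
    · exact hint 1 (by omega) (by omega) hlH.right_mem
    · exact hint i hi0 hi' hlH.left_mem
  have hnb : ∀ b ∈ Q.B, b ∈ V(P) → b ∉ V(H) → ∃ f ∈ F, P.IsNonloopAt f b := by
    intro b hbB hbP hbH
    rw [hV] at hbP
    obtain ⟨i, hi, rfl⟩ := hbP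
    have hi' : i ≤ n := hi
    have hi0 : 0 < i := Nat.pos_of_ne_zero fun h => hbH (h ▸ h0)
    have hin : i < n := lt_of_le_of_ne hi' fun h => hbH (h ▸ hvn)
    rcases hF i hi0 hin hbB with hf | hf
    · refine ⟨_, hf, ?_⟩
      have := hPl (i - 1) (by omega)
      rw [show i - 1 + 1 = i by omega] at this
      exact ⟨_, hb.ne_of_isLink (this.mono hP), this.symm⟩
    · exact ⟨_, hf, _, (hb.ne_of_isLink (hl i hin)).symm, hPl i hin⟩
  by_cases hcl : v n = v 0
  · have hcirc : IsCircuit P := by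
      refine ⟨n, v, e, by omega, hcl, hv, he, hPl, ?_, hE⟩
      rw [hV]
      ext x
      constructor
      · rintro ⟨i, hi, rfl⟩
        have hi' : i ≤ n := hi
        rcases hi'.lt_or_eq with h | rfl
        · exact ⟨i, h, rfl⟩
        · exact ⟨0, show 0 < i by omega, hcl.symm⟩
      · rintro ⟨i, hi, rfl⟩
        exact ⟨i, Set.mem_Iic.2 (le_of_lt (Set.mem_Iio.1 hi)), rfl⟩
    refine hH.addEar hQ ht hP hd hnb (Or.inl ⟨hEne, Or.inr ⟨hcirc, v 0, ?_⟩⟩) ?_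
    · rw [hVH, hcl, Set.pair_eq_singleton]
    · exact fun s t hst => absurd hst.2.1 (hcirc.not_isPathBetween s t)
  · have hpath : IsPathBetween P (v 0) (v n) := by
      refine ⟨n, v, e, rfl, rfl, ?_, hPl, hV, hE⟩
      have hlast : ∀ i < n, v i ≠ v n := by
        intro i hi hin
        rcases Nat.eq_zero_or_pos i with rfl | hi0
        · exact hcl hin.symm
        · exact hint i hi0 hi (hin ▸ hvn)
      intro i hi j hj hij
      have hi' : i ≤ n := hi
      have hj' : j ≤ n := hj
      rcases hi'.lt_or_eq with h1 | rfl <;> rcases hj'.lt_or_eq with h2 | rfl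
      · exact hv h1 h2 hij
      · exact absurd hij (hlast _ h1)
      · exact absurd hij.symm (hlast _ h2)
      · rfl
    refine hH.addEar hQ ht hP hd hnb (Or.inl ⟨hEne, Or.inl ⟨v 0, v n, hpath, hVH⟩⟩) ?_
    rintro s t ⟨-, -, hs⟩
    rw [hVH] at hs
    have h1 : v 0 ∈ ({s} : Set α) := hs ▸ Or.inl rfl
    have h2 : v n ∈ ({s} : Set α) := hs ▸ Or.inr rfl
    exact absurd (h2.trans h1.symm) hcl

/-- Joins for `x` and for `r` differ by a join for `{x, r}`, so `G` is connected; a subgraph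
containing `r` and every edge that meets it is all of `G`. -/
lemma Quad.HasThinJoins.exists_edge_of_ne {Q : Quad α β} {r : α} {H : Graph α β}
    (hQ : Q.HasThinJoins r) (hH : H ≤ Q.G) (hr : r ∈ V(H)) (hne : H ≠ Q.G) :
    ∃ e x y, Q.G.IsLink e x y ∧ x ∈ V(H) ∧ e ∉ E(H) := by
  have hb := hQ.isBipartiteGraft
  by_contra hc
  push Not at hc
  have hV : V(Q.G) ⊆ V(H) := by
    intro x hx
    by_cases hxr : x = r
    · exact hxr ▸ hr
    obtain ⟨F, hF, -⟩ := hQ.exists_thin x hx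
    obtain ⟨F', hF', -⟩ := hQ.exists_thin r (hH.vertexSet_mono hr)
    rw [symmDiff_pair_self] at hF'
    have hJ := hF'.symmDiff hb.finite_edgeSet hF
    rw [symmDiff_symmDiff_cancel_left] at hJ
    obtain ⟨n, v, e, h0, hvn, -, hlink⟩ := hJ.exists_path hb.finite_edgeSet hx hxr
    have : ∀ k ≤ n, v (n - k) ∈ V(H) := by
      intro k
      induction k with
      | zero => intro _; rw [Nat.sub_zero, hvn]; exact hr
      | succ k ih =>
        intro hk
        have hl := (hlink (n - (k + 1)) (by omega)).2
        rw [show n - (k + 1) + 1 = n - k by omega] at hl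
        exact ((hH.isLink_iff (hc _ _ _ hl.symm (ih (by omega)))).2 hl).left_mem
    have := this n le_rfl
    rwa [Nat.sub_self, h0] at this
  refine hne ((Compatible.of_le hH).ext (hH.vertexSet_mono.antisymm hV)
    (hH.edgeSet_mono.antisymm fun e he => ?_))
  obtain ⟨x, y, hl⟩ := exists_isLink_of_mem_edgeSet he
  exact hc e x y hl (hV hl.left_mem)

lemma Quad.IsGrown.exists_larger {Q : Quad α β} {r : α} {F : Set β} {H : Graph α β}
    (hQ : Q.HasThinJoins r) (hF : IsJoin Q.G Q.T F) (ht : IsThin Q.G Q.B F)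
    (hH : Q.IsGrown r F H) (hne : H ≠ Q.G) : ∃ H', Q.IsGrown r F H' ∧ E(H) ⊂ E(H') := by
  have hb := hQ.isBipartiteGraft
  have hE := hb.finite_edgeSet
  obtain ⟨f, x, y, hl, hx, hf⟩ := hQ.exists_edge_of_ne hH.le hH.root_mem hne
  by_cases hy : y ∉ V(H) → y ∈ Q.B → f ∈ F
  · exact hH.addEdge hQ ht hl hx hf hy
  push Not at hy
  obtain ⟨hyH, hyB, hfF⟩ := hy
  have hyV := hb.mem_vertexSet_right hyB
  have hyr : y ≠ r := fun h => hyH (h ▸ hH.root_mem)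
  obtain ⟨F', hF', ht'⟩ := hQ.exists_thin y hyV
  -- `y ∈ T` and `y ≠ r`, so `y` is even for `F'`; thinness turns even into zero.
  have hno : ∀ g ∈ F', ¬ Q.G.IsNonloopAt g y := by
    intro g hg hgn
    have h1 := (hF'.mem_iff_of_subsingleton hyV (ht' y hyB)).2 ⟨g, hg, hgn⟩
    have h2 := (hQ.mem_T_iff y hyB).2 hyr
    simp only [Set.mem_symmDiff, Set.mem_singleton_iff] at h1
    tauto
  have hJ := hF.symmDiff hE hF'
  rw [symmDiff_symmDiff_cancel_left] at hJ
  obtain ⟨m, w, e, hw0, hwm, hinj, hlink⟩ := hJ.exists_path hE hyV hyr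
  have hex : ∃ k, w k ∈ V(H) := ⟨m, hwm ▸ hH.root_mem⟩
  classical
  obtain ⟨k, hkH, hkmin⟩ : ∃ k, w k ∈ V(H) ∧ ∀ j < k, w j ∉ V(H) :=
    ⟨Nat.find hex, Nat.find_spec hex, fun j hj => Nat.find_min hex hj⟩
  have hkm : k ≤ m := by
    by_contra hc
    exact hkmin m (by omega) (hwm ▸ hH.root_mem)
  have hk0 : 0 < k := Nat.pos_of_ne_zero fun h => hyH (by rw [← hw0, ← h]; exact hkH)
  have hinje := injOn_edges_of_path hinj fun i hi => (hlink i hi).2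
  -- `f` is not in `F`, and not in `F'` as it meets `y`; hence it is not an edge of the path and the
  -- ear repeats no edge.
  have hfJ : f ∉ F ∆ F' := by
    rintro (h | h)
    · exact hfF h.1
    · exact hno f h.1 (hb.isNonloopAt_of_isLink hl.symm)
  -- Indices are shifted by one to put `x` and `f` before the path `w 0 = y, …, w k`.
  refine hH.addRound (n := k + 1) (v := fun i => if i = 0 then x else w (i - 1))
    (e := fun i => if i = 0 then f else e (i - 1)) hQ ht (by omega) ?_ ?_ ?_ ?_ ?_ ?_ ?_
  · rintro (_ | i) hi
    · simpa [hw0] using hl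
    · simpa using (hlink i (by omega)).2
  · rintro (_ | i) hi (_ | j) hj hij
    · rfl
    · simp only [if_true, Nat.add_eq_zero_iff, one_ne_zero, and_false, if_false,
        Nat.add_sub_cancel] at hij
      simp only [Set.mem_Iio] at hj
      exact absurd (hij ▸ hx) (hkmin j (by omega))
    · simp only [if_true, Nat.add_eq_zero_iff, one_ne_zero, and_false, if_false,
        Nat.add_sub_cancel] at hij
      simp only [Set.mem_Iio] at hi
      exact absurd (hij ▸ hx) (hkmin i (by omega))
    · simp only [Nat.add_eq_zero_iff, one_ne_zero, and_false, if_false,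
        Nat.add_sub_cancel] at hij
      simp only [Set.mem_Iio] at hi hj
      rw [hinj (show i ∈ Set.Iic m by simp; omega) (show j ∈ Set.Iic m by simp; omega) hij]
  · rintro (_ | i) hi (_ | j) hj hij
    · rfl
    · simp only [if_true, Nat.add_eq_zero_iff, one_ne_zero, and_false, if_false,
        Nat.add_sub_cancel] at hij
      simp only [Set.mem_Iio] at hj
      exact absurd (hij ▸ (hlink j (by omega)).1) hfJ
    · simp only [if_true, Nat.add_eq_zero_iff, one_ne_zero, and_false, if_false,
        Nat.add_sub_cancel] at hij
      simp only [Set.mem_Iio] at hi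
      exact absurd (hij ▸ (hlink i (by omega)).1) hfJ
    · simp only [Nat.add_eq_zero_iff, one_ne_zero, and_false, if_false,
        Nat.add_sub_cancel] at hij
      simp only [Set.mem_Iio] at hi hj
      rw [hinje (show i ∈ Set.Iio m by simp; omega) (show j ∈ Set.Iio m by simp; omega) hij]
  · simpa using hx
  · simpa using hkH
  · rintro (_ | i) hi0 hi
    · omega
    · simpa using hkmin i (by omega)
  -- At `y` the path edge must be in `F`, because `F'` has no edge there. At a later interior vertex
  -- of `B`, if neither path edge were in `F`, both would be in `F'`, against thinness.
  · rintro (_ | _ | i) hi0 hi hiB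
    · omega
    · right
      have h1 := hlink 0 (by omega)
      rw [hw0] at h1
      rcases h1.1 with h | h
      · simpa using h.1
      · exact absurd (hb.isNonloopAt_of_isLink h1.2) (hno _ h.1)
    · simp only [Nat.add_eq_zero_iff, one_ne_zero, and_false, if_false,
        Nat.add_sub_cancel] at hiB ⊢
      by_contra hc
      push Not at hc
      have h1 := hlink i (by omega)
      have h2 := hlink (i + 1) (by omega)
      have h3 : e i ∈ F' := (h1.1.resolve_left fun h => hc.1 h.1).1
      have h4 : e (i + 1) ∈ F' := (h2.1.resolve_left fun h => hc.2 h.1).1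
      have h5 := ht' _ hiB ⟨h3, hb.isNonloopAt_of_isLink h1.2.symm⟩
        ⟨h4, hb.isNonloopAt_of_isLink h2.2⟩
      have := hinje (show i ∈ Set.Iio m by simp; omega) (show i + 1 ∈ Set.Iio m by simp; omega) h5
      omega

theorem Quad.HasThinJoins.criticalFamily {Q : Quad α β} {r : α} (h : Q.HasThinJoins r) :
    CriticalFamily r Q := by
  have hb := h.isBipartiteGraft
  obtain ⟨F, hF, ht⟩ := h.exists_thin r (hb.mem_vertexSet_right h.root_mem)
  rw [symmDiff_pair_self] at hF
  have key : ∀ k, ∀ H, Q.IsGrown r F H → (E(Q.G) \ E(H)).ncard = k → CriticalFamily r Q := by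
    intro k
    induction k using Nat.strong_induction_on with
    | _ k ih =>
      intro H hH hk
      by_cases hne : H = Q.G
      · have := hH.family
        rwa [hne, Quad.part_self hb hF] at this
      · obtain ⟨H', hH', hlt⟩ := hH.exists_larger h hF ht hne
        refine ih _ ?_ H' hH' rfl
        rw [← hk]
        refine Set.ncard_lt_ncard ⟨Set.sdiff_subset_sdiff_right hlt.1, fun hs => ?_⟩
          (hb.finite_edgeSet.subset Set.sdiff_subset)
        obtain ⟨e, he, heH⟩ := Set.exists_of_ssubset hlt
        exact (hs ⟨hH'.le.edgeSet_mono he, heH⟩).2 he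
  exact key _ _ (h.isGrown_noEdge hF ht) rfl

end

end BipGraft

theorem theorem11p5 {α β : Type*} (Q : BipGraft.Quad α β) (r : α) :
    Q.IsCriticalQuasicomb r ↔ BipGraft.CriticalFamily r Q :=
  ⟨fun h => h.hasThinJoins.criticalFamily, fun h => h.hasThinJoins.isCriticalQuasicomb⟩
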